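/- **Conventions.** Let $\Bbbk$ be a field. A *fiat 2-category* $\mathcal C$ over $\Bbbk$ is a strict, additive, $\Bbbk$-linear 2-category with finitely many objects, such that every category $\mathcal C(\mathtt i,\mathtt j)$ of 1-morphisms is additive with split idempotents, has finitely many indecomposable objects up to isomorphism and finite-dimensional morphism spaces, horizontal and vertical compositions are $\Bbbk$-bilinear, every identity 1-morphism $\mathbb 1_{\mathtt i}$ is indecomposable, and there is a weak involution $*$ (the identity on objects, reversing 1-morphisms and 2-morphisms, compatible with compositions and identities up to coherent natural isomorphism, with square isomorphic to the identity) such that for every 1-morphism $f\in\mathcal C(\mathtt i,\mathtt j)$ there are 2-morphisms $f\circ f^*\to\mathbb 1_{\mathtt j}$ and $\mathbb 1_{\mathtt i}\to f^*\circ f$ satisfying the two adjunction (triangle) identities. For an object $\mathtt i$ let $\overline{\mathbf P}_{\mathtt i}$ be the principal 2-representation: $\overline{\mathbf P}_{\mathtt i}(\mathtt j)$ has as objects the morphisms $X\xrightarrow{a}Y$ of $\mathcal C(\mathtt i,\mathtt j)$ and as morphisms the commutative squares $(b,b')$ from $a$ to $a'$ modulo those for which $b'=a'c$ for some $c$; a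 1-morphism $f\in\mathcal C(\mathtt j,\mathtt k)$ acts by applying $f\circ{}_-$ componentwise, and similarly for 2-morphisms. For a 1-morphism $f\in\mathcal C(\mathtt i,\mathtt j)$ put $P_f=(0\to f)$; for $f$ indecomposable let $L_f$ be the unique simple quotient of $P_f$. Denote by $[M:S]$ the multiplicity of a simple object $S$ as a composition factor of $M$, and by $\mathrm{add}$ the closure under finite direct sums and direct summands. For indecomposable 1-morphisms $f$, $g$ starting at the same object write $f\le_R g$ if $g$ is isomorphic to a direct summand of $h\circ f$ for some 1-morphism $h$. A *right cell* $\mathcal R$ is an equivalence class (of isomorphism classes of indecomposable 1-morphisms) for the equivalence relation "$f\le_R g$ and $g\le_R f$". All elements of $\mathcal R$ start at one object $\mathtt i$; write $\mathcal R_{\mathtt j}$ for the set of elements of $\mathcal R$ that end at $\mathtt j$. **Theorem (Construction of cell modules).** Let $\mathcal C$ be a fiat 2-category over $\Bbbk$ and $\mathcal R$ a right cell whose elements start at $\mathtt i$. There are a subobject $K\subseteq P_{\mathbb 1_{\mathtt i}}$ and an indecomposable $g_{\mathcal R}\in\mathcal C(\mathtt i,\mathtt i)$ such that every simple subquotient of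 $P_{\mathbb 1_{\mathtt i}}/K$ is annihilated by every $f\in\mathcal R$, while $K$ has simple top $L_{g_{\mathcal R}}$ and $f\,L_{g_{\mathcal R}}\ne0$ for every $f\in\mathcal R$. For any such $K$ and $g_{\mathcal R}$ put $L=L_{g_{\mathcal R}}$. Then: (a) For every $g\in\mathcal R_{\mathtt j}$ and every indecomposable 1-morphism $f$ starting at $\mathtt j$, the object $(f\circ g)\,L$ is isomorphic to a finite (possibly empty) direct sum of objects $h\,L$ with $h\in\mathcal R$. (b) For all $f,h\in\mathcal R_{\mathtt j}$ the space $\mathrm{Hom}(f\,L,h\,L)$ is finite-dimensional, and $$\dim_{\Bbbk}\mathrm{Hom}(f\,L,h\,L)=[h\,L:L_f]\cdot\dim_{\Bbbk}\mathrm{End}(L_f).$$ In particular, if $\Bbbk$ is algebraically closed, then $\dim_{\Bbbk}\mathrm{Hom}(f\,L,h\,L)=[h\,L:L_f]$. (c) For every $f\in\mathcal R$ there is an epimorphism $P_f\twoheadrightarrow f\,L$, and it has a kernel. Whatever the epimorphisms chosen, if $\mathrm{Ker}_f$ denotes the kernel of the one for $f$, then for every $\mathtt j$ the subobject $\bigoplus_f\mathrm{Ker}_f$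 of $\bigoplus_f P_f$, where $f$ runs over any finite family of elements of $\mathcal R_{\mathtt j}$ (for instance all of $\mathcal R_{\mathtt j}$), is stable under every endomorphism of $\bigoplus_f P_f$. (d) For every $\mathtt j$ let $\mathcal D_{\mathcal R,\mathtt j}$ be the full subcategory of $\overline{\mathbf P}_{\mathtt i}(\mathtt j)$ with objects $g\,L$, $g\in\mathcal R_{\mathtt j}$, and let $\mathbf C_{\mathcal R}(\mathtt j)$ be the full subcategory of $\overline{\mathbf P}_{\mathtt i}(\mathtt j)$ consisting of all $M$ that have an exact presentation $X_1\to X_0\to M\to0$ with $X_1,X_0\in\mathrm{add}\bigl(\bigoplus_{f\in\mathcal R_{\mathtt j}}f\,L\bigr)$. Then $\mathbf C_{\mathcal R}(\mathtt j)$ is $\Bbbk$-linearly equivalent to $\mathcal D_{\mathcal R,\mathtt j}^{\mathrm{op}}\text{-}\mathrm{mod}$, the category of $\Bbbk$-linear functors from $\mathcal D_{\mathcal R,\mathtt j}^{\mathrm{op}}$ to finite-dimensional $\Bbbk$-vector spaces. (e) The subcategories $\mathbf C_{\mathcal R}(\mathtt j)$ are stable under the action of all 1-morphisms, so that restriction from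 $\overline{\mathbf P}_{\mathtt i}$ is a $\Bbbk$-linear 2-representation (strict 2-functor) $\mathbf C_{\mathcal R}$ of $\mathcal C$, and each $\mathbf C_{\mathcal R}(\mathtt j)$ is $\Bbbk$-linearly equivalent to the category of finite-dimensional modules over some finite-dimensional $\Bbbk$-algebra. This 2-representation is the *cell module* of $\mathcal R$. -/

import Mathlib

open CategoryTheory CategoryTheory.Limits CategoryTheory.Preadditive Opposite

universe w v u t w₁ w₂ v₁ v₂

noncomputable section

namespace CellRep

section Abelianization

variable (k : Type t) [Field k]
variable {V : Type v₁} [Category.{w₁} V] [Preadditive V]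
variable {W : Type v₂} [Category.{w₂} W] [Preadditive W]

/-- The `k`-linear structure on the category of arrows of a `k`-linear category (componentwise). -/
instance arrowLinear [Linear k V] : Linear k (Arrow V) where
  homModule X Y :=
    { smul := fun a f => Arrow.homMk (a • f.left) (a • f.right) (by simp)
      one_smul := fun f => by ext <;> exact one_smul k _
      mul_smul := fun a b f => by ext <;> exact mul_smul a b _
      smul_zero := fun a => by ext <;> exact smul_zero a
      smul_add := fun a f g => by ext <;> exact smul_add a _ _
      add_smul := fun a b f => by ext <;> exact add_smul a b _
      zero_smul := fun f => by ext <;> exact zero_smul k _ }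
  smul_comp X Y Z a f g := by ext <;> exact Linear.smul_comp _ _ _ _ _ _
  comp_smul X Y Z f a g := by ext <;> exact Linear.comp_smul _ _ _ _ _ _

/-- The `k`-linear structure on the abelianization `RightFreyd V` of a `k`-linear category. Objects of
`RightFreyd V` are arrows `X ⟶ Y` of `V`, morphisms are commutative squares `(b, c)` modulo those
for which `c` factors through the target arrow. -/
instance freydLinear [Linear k V] : Linear k (RightFreyd V) :=
  letI : Preadditive (CategoryTheory.Quotient (Arrow.rightHomotopic V)) :=
    inferInstanceAs (Preadditive (RightFreyd V))
  haveI : (CategoryTheory.Quotient.functor (Arrow.rightHomotopic V)).Additive :=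
    inferInstanceAs (RightFreyd.quotient V).Additive
  CategoryTheory.Quotient.linear k (Arrow.rightHomotopic V) (by
    rintro a X Y f g ⟨h⟩
    exact ⟨⟨a • h.hom, by
      have := congrArg (fun x => a • x) h.comm
      simpa [smul_sub] using! this⟩⟩)

instance freydQuotientLinear [Linear k V] : (RightFreyd.quotient V).Linear k where
  map_smul _ _ := rfl

/-- The abelianization of an additive category has finite direct sums. -/
instance freydBiproducts [HasFiniteBiproducts V] : HasFiniteBiproducts (RightFreyd V) := by
  have : HasFiniteProducts (Arrow V) := ⟨fun n => inferInstanceAs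
    (HasLimitsOfShape _ (Comma (𝟭 V) (𝟭 V)))⟩
  have : HasFiniteBiproducts (Arrow V) := HasFiniteBiproducts.of_hasFiniteProducts
  refine ⟨fun n => ⟨fun F => ?_⟩⟩
  exact inferInstanceAs
    (HasBiproduct fun i => (RightFreyd.quotient V).obj (F i).as)

variable {k}

/-- The functor between abelianizations given by applying an additive functor componentwise. -/
def freydMap (F : V ⥤ W) [F.Additive] : RightFreyd V ⥤ RightFreyd W :=
  CategoryTheory.Quotient.lift (Arrow.rightHomotopic V)
    (F.mapArrow ⋙ RightFreyd.quotient W) (by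
    rintro X Y f g ⟨h⟩
    exact RightFreyd.eq_of_rightHomotopy _ _ ⟨F.map h.hom, by
      have := congrArg (fun x => F.map x) h.comm
      simpa using! this⟩)

lemma freydMap_map (F : V ⥤ W) [F.Additive] {X Y : Arrow V} (f : X ⟶ Y) :
    (freydMap F).map ((RightFreyd.quotient V).map f) =
      (RightFreyd.quotient W).map (F.mapArrow.map f) := rfl

lemma freyd_induction {P : ∀ {X Y : RightFreyd V}, (X ⟶ Y) → Prop}
    (h : ∀ {X Y : Arrow V} (f : X ⟶ Y), P ((RightFreyd.quotient V).map f))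
    {X Y : RightFreyd V} (f : X ⟶ Y) : P f :=
  CategoryTheory.Quotient.induction (Arrow.rightHomotopic V) h f

instance (F : V ⥤ W) [F.Additive] : (freydMap F).Additive where
  map_add {X Y f g} := by
    have key : ∀ {X Y : Arrow V} (f g : X ⟶ Y),
        (freydMap F).map ((RightFreyd.quotient V).map f + (RightFreyd.quotient V).map g) =
        (freydMap F).map ((RightFreyd.quotient V).map f) +
        (freydMap F).map ((RightFreyd.quotient V).map g) := by
      intro X Y f g
      rw [← Functor.map_add, freydMap_map, freydMap_map, freydMap_map]
      erw [← Functor.map_add]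
      congr 1
      ext <;> exact F.map_add
    obtain ⟨f, rfl⟩ := (RightFreyd.quotient V).map_surjective f
    obtain ⟨g, rfl⟩ := (RightFreyd.quotient V).map_surjective g
    exact key f g

instance [Linear k V] [Linear k W] (F : V ⥤ W) [F.Additive] [F.Linear k] :
    (freydMap F).Linear k where
  map_smul {X Y} f a := by
    have key : ∀ {X Y : Arrow V} (f : X ⟶ Y),
        (freydMap F).map (a • (RightFreyd.quotient V).map f) =
        a • (freydMap F).map ((RightFreyd.quotient V).map f) := by
      intro X Y f
      rw [← Functor.map_smul, freydMap_map, freydMap_map]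
      erw [← Functor.map_smul]
      congr 1
      ext <;> exact F.map_smul _ _
    obtain ⟨f, rfl⟩ := (RightFreyd.quotient V).map_surjective f
    exact key f

/-- The componentwise action of a natural transformation on arrows. -/
def mapArrowNat {F G : V ⥤ W} (η : F ⟶ G) : F.mapArrow ⟶ G.mapArrow where
  app X := Arrow.homMk (η.app X.left) (η.app X.right) (η.naturality X.hom).symm
  naturality X Y f := by
    ext
    · exact η.naturality f.left
    · exact η.naturality f.right

/-- The componentwise action of a natural transformation on abelianizations. -/
def freydNat {F G : V ⥤ W} [F.Additive] [G.Additive] (η : F ⟶ G) :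
    freydMap F ⟶ freydMap G :=
  CategoryTheory.Quotient.natTransLift (Arrow.rightHomotopic V)
    (Functor.whiskerRight (mapArrowNat η) (RightFreyd.quotient W))

end Abelianization

section Strictness

open Bicategory

variable {C : Type u} [Bicategory.{w, v} C] [Bicategory.Strict C]

lemma postcomp_id (i j : C) : postcomp i (𝟙 j) = 𝟭 (i ⟶ j) :=
  CategoryTheory.Functor.ext (fun X => Strict.comp_id X) (fun X Y f => by
    have h := Bicategory.whiskerRight_id f
    rw [Strict.rightUnitor_eqToIso, Strict.rightUnitor_eqToIso] at h
    exact h)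

lemma postcomp_comp (i : C) {j l m : C} (f : j ⟶ l) (g : l ⟶ m) :
    postcomp i (f ≫ g) = postcomp i f ⋙ postcomp i g :=
  CategoryTheory.Functor.ext (fun X => (Strict.assoc X f g).symm) (fun X Y η => by
    have h := Bicategory.whiskerRight_comp η f g
    rw [Strict.associator_eqToIso, Strict.associator_eqToIso] at h
    exact h)

lemma whisker_left_key {i j l m : C} (f : j ⟶ l) {g g' : l ⟶ m} (η : g ⟶ g') (Y : i ⟶ j) :
    ∃ h₁ h₂, Y ◁ f ◁ η = eqToHom h₁ ≫ (Y ≫ f) ◁ η ≫ eqToHom h₂ := by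
  refine ⟨(Strict.assoc Y f g).symm, Strict.assoc Y f g', ?_⟩
  have h := Bicategory.comp_whiskerLeft Y f η
  rw [Strict.associator_eqToIso, Strict.associator_eqToIso] at h
  rw [h]; simp

lemma whisker_right_key {i j l m : C} {f f' : j ⟶ l} (η : f ⟶ f') (g : l ⟶ m) (Y : i ⟶ j) :
    ∃ h₁ h₂, Y ◁ (η ▷ g) = eqToHom h₁ ≫ (Y ◁ η) ▷ g ≫ eqToHom h₂ := by
  refine ⟨(Strict.assoc Y f g).symm, Strict.assoc Y f' g, ?_⟩
  have h := Bicategory.whisker_assoc Y η g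
  rw [Strict.associator_eqToIso, Strict.associator_eqToIso] at h
  rw [h]; simp

end Strictness

section TwoCategories

variable (k : Type t) [Field k] (C : Type u) [Bicategory.{w, v} C]

open Bicategory

/-- An additive 2-category: all categories of 1-morphisms are additive and horizontal composition is
biadditive. Composition of 1-morphisms is written in diagrammatic order, so `g ≫ f` is `f ∘ g`. -/
class AdditiveTwoCategory where
  preadditive (i j : C) : Preadditive (i ⟶ j)
  hasFiniteBiproducts (i j : C) : HasFiniteBiproducts (i ⟶ j)
  whiskerLeft_add {i j l : C} (f : i ⟶ j) {g h : j ⟶ l} (η θ : g ⟶ h) :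
    f ◁ (η + θ) = f ◁ η + f ◁ θ
  add_whiskerRight {i j l : C} {f g : i ⟶ j} (η θ : f ⟶ g) (h : j ⟶ l) :
    (η + θ) ▷ h = η ▷ h + θ ▷ h

attribute [reducible, instance] AdditiveTwoCategory.preadditive
attribute [instance] AdditiveTwoCategory.hasFiniteBiproducts

/-- A `k`-linear additive 2-category: spaces of 2-morphisms are `k`-vector spaces and all compositions
are `k`-bilinear. -/
class LinearTwoCategory [AdditiveTwoCategory C] where
  linear (i j : C) : Linear k (i ⟶ j)
  whiskerLeft_smul {i j l : C} (f : i ⟶ j) {g h : j ⟶ l} (a : k) (η : g ⟶ h) :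
    f ◁ (a • η) = a • (f ◁ η)
  smul_whiskerRight {i j l : C} {f g : i ⟶ j} (a : k) (η : f ⟶ g) (h : j ⟶ l) :
    (a • η) ▷ h = a • (η ▷ h)

attribute [reducible, instance] LinearTwoCategory.linear

/-- A `k`-linear 2-representation: a strict 2-functor to `k`-linear categories, `k`-linear functors and
natural transformations, which is `k`-linear on 2-morphisms. -/
structure TwoRep [AdditiveTwoCategory C] [LinearTwoCategory k C] where
  toTwoFunctor : StrictPseudofunctor C Cat.{w₁, v₁}
  preadditive (j : C) : Preadditive (toTwoFunctor.obj j)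
  linear (j : C) : Linear k (toTwoFunctor.obj j)
  map_additive {j l : C} (f : j ⟶ l) : (toTwoFunctor.map f).toFunctor.Additive
  map_linear {j l : C} (f : j ⟶ l) : (toTwoFunctor.map f).toFunctor.Linear k
  map₂_add {j l : C} {f g : j ⟶ l} (η θ : f ⟶ g) (X : toTwoFunctor.obj j) :
    (toTwoFunctor.map₂ (η + θ)).toNatTrans.app X =
      (toTwoFunctor.map₂ η).toNatTrans.app X + (toTwoFunctor.map₂ θ).toNatTrans.app X
  map₂_smul {j l : C} {f g : j ⟶ l} (a : k) (η : f ⟶ g) (X : toTwoFunctor.obj j) :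
    (toTwoFunctor.map₂ (a • η)).toNatTrans.app X =
      a • (toTwoFunctor.map₂ η).toNatTrans.app X

attribute [instance] TwoRep.preadditive TwoRep.linear TwoRep.map_additive TwoRep.map_linear

variable {C} [AdditiveTwoCategory C]

instance postcomp_additive (i : C) {j l : C} (f : j ⟶ l) : (postcomp i f).Additive where
  map_add := AdditiveTwoCategory.add_whiskerRight _ _ f

instance postcomp_linear [LinearTwoCategory k C] (i : C) {j l : C} (f : j ⟶ l) :
    (postcomp i f).Linear k where
  map_smul η a := LinearTwoCategory.smul_whiskerRight a η f

/-- The value at `j` of the `i`-th principal 2-representation: the abelianization of the category of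
1-morphisms from `i` to `j`. -/
abbrev PBar (i j : C) := RightFreyd (i ⟶ j)

/-- The action of a 1-morphism `f` on the principal 2-representation: composition with `f`, applied
componentwise to arrows. -/
def act {i j l : C} (f : j ⟶ l) : PBar i j ⥤ PBar i l := freydMap (postcomp i f)

instance {i j l : C} (f : j ⟶ l) : (act (i := i) f).Additive :=
  inferInstanceAs (freydMap (postcomp i f)).Additive

instance [LinearTwoCategory k C] {i j l : C} (f : j ⟶ l) : (act (i := i) f).Linear k :=
  inferInstanceAs ((freydMap (postcomp i f)).Linear k)

/-- The action of a 2-morphism on the principal 2-representation. -/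
def actMap {i j l : C} {f g : j ⟶ l} (η : f ⟶ g) : act (i := i) f ⟶ act g :=
  freydNat ((postcomposing i j l).map η)

variable [Bicategory.Strict C]

lemma freyd_functor_ext {V : Type v₁} [Category.{w₁} V] [Preadditive V]
    {D : Type v₂} [Category.{w₂} D] {F G : RightFreyd V ⥤ D}
    (h : RightFreyd.quotient V ⋙ F = RightFreyd.quotient V ⋙ G) : F = G :=
  CategoryTheory.Quotient.lift_unique' _ _ _ h

lemma freydMap_congr {V : Type v₁} [Category.{w₁} V] [Preadditive V]
    {W : Type v₂} [Category.{w₂} W] [Preadditive W] {F G : V ⥤ W} [F.Additive] [G.Additive]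
    (h : F = G) : freydMap F = freydMap G := by
  subst h; rfl

lemma act_id (i j : C) : act (i := i) (𝟙 j) = 𝟭 (PBar i j) :=
  (freydMap_congr (postcomp_id i j)).trans (freyd_functor_ext rfl)

lemma act_comp {i j l m : C} (f : j ⟶ l) (g : l ⟶ m) :
    act (i := i) (f ≫ g) = act f ⋙ act g :=
  (freydMap_congr (postcomp_comp i f g)).trans (freyd_functor_ext rfl)

variable (i : C)

lemma actMap_app {i j l : C} {f g : j ⟶ l} (η : f ⟶ g) (X : Arrow (i ⟶ j)) :
    (actMap η).app ((RightFreyd.quotient (i ⟶ j)).obj X) =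
      (RightFreyd.quotient (i ⟶ l)).map
        ((mapArrowNat ((postcomposing i j l).map η)).app X) := rfl

lemma freyd_conj {V : Type v₁} [Category.{w₁} V] [Preadditive V] {A B A' B' : Arrow V}
    (φ : A ⟶ B) (ψ : A' ⟶ B')
    (h : (RightFreyd.quotient V).obj A = (RightFreyd.quotient V).obj A')
    (h' : (RightFreyd.quotient V).obj B' = (RightFreyd.quotient V).obj B)
    (hl : ∃ h₁ h₂, φ.left = eqToHom h₁ ≫ ψ.left ≫ eqToHom h₂)
    (hr : ∃ h₁ h₂, φ.right = eqToHom h₁ ≫ ψ.right ≫ eqToHom h₂) :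
    (RightFreyd.quotient V).map φ =
      eqToHom h ≫ (RightFreyd.quotient V).map ψ ≫ eqToHom h' := by
  obtain rfl : A = A' := congrArg CategoryTheory.Quotient.as h
  obtain rfl : B' = B := congrArg CategoryTheory.Quotient.as h'
  obtain ⟨_, _, hl⟩ := hl
  obtain ⟨_, _, hr⟩ := hr
  rw [eqToHom_refl, eqToHom_refl, Category.id_comp, Category.comp_id]
  congr 1
  ext
  · simpa using hl
  · simpa using hr

/-- The data of the `i`-th principal 2-representation as a strict 2-functor to categories. -/
def principalCore : StrictPseudofunctorPreCore C Cat.{w, max v w} where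
  obj j := Cat.of (PBar i j)
  map f := (act f).toCatHom
  map₂ η := (actMap η).toCatHom₂
  map₂_id f := by
    apply Cat.Hom₂.ext
    refine NatTrans.ext (funext fun X => ?_)
    refine Eq.trans (congrArg (RightFreyd.quotient _).map (?_ : _ = 𝟙 _)) ((RightFreyd.quotient _).map_id _)
    ext
    · exact Bicategory.whiskerLeft_id _ _
    · exact Bicategory.whiskerLeft_id _ _
  map₂_comp η θ := by
    apply Cat.Hom₂.ext
    refine NatTrans.ext (funext fun X => ?_)
    refine Eq.trans (congrArg (RightFreyd.quotient _).map
      (?_ : _ = (mapArrowNat ((postcomposing _ _ _).map η)).app X.as ≫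
        (mapArrowNat ((postcomposing _ _ _).map θ)).app X.as))
      ((RightFreyd.quotient _).map_comp _ _)
    ext
    · exact Bicategory.whiskerLeft_comp _ _ _
    · exact Bicategory.whiskerLeft_comp _ _ _
  map_id j := Cat.ext (act_id i j)
  map_comp f g := Cat.ext (act_comp f g)
  map₂_whisker_left {_ _ _} f g g' η := by
    apply Cat.Hom₂.ext
    refine NatTrans.ext (funext fun X => ?_)
    simp only [Cat.Hom₂.comp_app, Cat.eqToHom_app]
    exact freyd_conj
      ((mapArrowNat ((postcomposing _ _ _).map (f ◁ η))).app X.as)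
      ((mapArrowNat ((postcomposing _ _ _).map η)).app ((postcomp i f).mapArrow.obj X.as))
      _ _ (whisker_left_key f η X.as.left) (whisker_left_key f η X.as.right)
  map₂_whisker_right {_ _ _} {f f'} η g := by
    apply Cat.Hom₂.ext
    refine NatTrans.ext (funext fun X => ?_)
    simp only [Cat.Hom₂.comp_app, Cat.eqToHom_app]
    exact freyd_conj
      ((mapArrowNat ((postcomposing _ _ _).map (η ▷ g))).app X.as)
      ((postcomp i g).mapArrow.map ((mapArrowNat ((postcomposing _ _ _).map η)).app X.as))
      _ _ (whisker_right_key η g X.as.left) (whisker_right_key η g X.as.right)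

/-- The `i`-th principal 2-representation. -/
def principal [LinearTwoCategory k C] : TwoRep k C where
  toTwoFunctor := StrictPseudofunctor.mk'' (principalCore i)
  preadditive j := inferInstanceAs (Preadditive (PBar i j))
  linear j := inferInstanceAs (Linear k (PBar i j))
  map_additive f := inferInstanceAs (act f).Additive
  map_linear f := inferInstanceAs ((act f).Linear k)
  map₂_add η θ X := by
    refine congrArg (RightFreyd.quotient _).map
      (?_ : _ = (mapArrowNat ((postcomposing _ _ _).map η)).app X.as +
        (mapArrowNat ((postcomposing _ _ _).map θ)).app X.as)
    ext
    · exact AdditiveTwoCategory.whiskerLeft_add _ _ _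
    · exact AdditiveTwoCategory.whiskerLeft_add _ _ _
  map₂_smul a η X := by
    refine congrArg (RightFreyd.quotient _).map
      (?_ : _ = a • (mapArrowNat ((postcomposing _ _ _).map η)).app X.as)
    ext
    · exact LinearTwoCategory.whiskerLeft_smul _ _ _
    · exact LinearTwoCategory.whiskerLeft_smul _ _ _


variable {i k}
variable [LinearTwoCategory k C]

/-- A family of full subcategories is stable under the action of all 1-morphisms. -/
def TwoRep.IsStable (M : TwoRep.{w, v, u, t, w₁, v₁} k C) (Q : ∀ j : C, ObjectProperty (M.toTwoFunctor.obj j)) : Prop :=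
  ∀ ⦃j l : C⦄ (f : j ⟶ l) (X : M.toTwoFunctor.obj j), Q j X →
    Q l ((M.toTwoFunctor.map f).toFunctor.obj X)

section Restrict

variable (M : TwoRep.{w, v, u, t, w₁, v₁} k C) (Q : ∀ j : C, ObjectProperty (M.toTwoFunctor.obj j))
  (hQ : M.IsStable Q)

/-- The restriction of the action of a 1-morphism to a stable family of full subcategories. -/
def restrictFunctor {j l : C} (f : j ⟶ l) : (Q j).FullSubcategory ⥤ (Q l).FullSubcategory :=
  (Q l).lift ((Q j).ι ⋙ (M.toTwoFunctor.map f).toFunctor) (fun X => hQ f X.obj X.property)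

lemma fullSub_conj {A : Type v₁} [Category.{w₁} A] {P : ObjectProperty A}
    {X Y X' Y' : P.FullSubcategory} (φ : X ⟶ Y) (ψ : X' ⟶ Y') (h : X = X') (h' : Y' = Y)
    (hh : ∃ h₁ h₂, φ.hom = eqToHom h₁ ≫ ψ.hom ≫ eqToHom h₂) :
    φ = eqToHom h ≫ ψ ≫ eqToHom h' := by
  subst h h'
  obtain ⟨_, _, hh⟩ := hh
  apply ObjectProperty.hom_ext
  simpa using hh

lemma fullSub_functor_ext {A : Type v₁} [Category.{w₁} A] {P : ObjectProperty A}
    {B : Type v₂} [Category.{w₂} B] {F G : B ⥤ P.FullSubcategory}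
    (h : F ⋙ P.ι = G ⋙ P.ι) : F = G :=
  CategoryTheory.Functor.ext
    (fun X => ObjectProperty.FullSubcategory.ext (CategoryTheory.Functor.congr_obj h X))
    (fun _ _ f => fullSub_conj _ _ _ _ ⟨_, _, CategoryTheory.Functor.congr_hom h f⟩)

instance restrictFunctor_additive {j l : C} (f : j ⟶ l) :
    (restrictFunctor M Q hQ f).Additive where
  map_add := ObjectProperty.hom_ext _ ((M.toTwoFunctor.map f).toFunctor.map_add)

instance restrictFunctor_linear {j l : C} (f : j ⟶ l) :
    (restrictFunctor M Q hQ f).Linear k where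
  map_smul η a := ObjectProperty.hom_ext _
    ((M.toTwoFunctor.map f).toFunctor.map_smul a η.hom)

/-- The restricted action as a strict 2-functor to categories. -/
def restrictCore : StrictPseudofunctorPreCore C Cat.{w₁, v₁} where
  obj j := Cat.of (Q j).FullSubcategory
  map f := (restrictFunctor M Q hQ f).toCatHom
  map₂ {_ _ _ _} η := NatTrans.toCatHom₂
    { app := fun X => ObjectProperty.homMk ((M.toTwoFunctor.map₂ η).toNatTrans.app X.obj)
      naturality := fun X Y f => ObjectProperty.hom_ext _
        ((M.toTwoFunctor.map₂ η).toNatTrans.naturality f.hom) }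
  map₂_id f := by
    apply Cat.Hom₂.ext
    refine NatTrans.ext (funext fun X => ObjectProperty.hom_ext _ ?_)
    have := M.toTwoFunctor.map₂_id f
    exact congrArg (fun z => z.toNatTrans.app X.obj) this
  map₂_comp η θ := by
    apply Cat.Hom₂.ext
    refine NatTrans.ext (funext fun X => ObjectProperty.hom_ext _ ?_)
    have := M.toTwoFunctor.map₂_comp η θ
    exact congrArg (fun z => z.toNatTrans.app X.obj) this
  map_id j := by
    apply Cat.ext
    apply fullSub_functor_ext
    exact congrArg (fun z => (Q j).ι ⋙ Cat.Hom.toFunctor z) (M.toTwoFunctor.map_id j)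
  map_comp {j _ _} f g := by
    apply Cat.ext
    apply fullSub_functor_ext
    exact congrArg (fun z => (Q j).ι ⋙ Cat.Hom.toFunctor z) (M.toTwoFunctor.map_comp f g)
  map₂_whisker_left {_ _ _} f g g' η := by
    apply Cat.Hom₂.ext
    refine NatTrans.ext (funext fun X => ?_)
    simp only [Cat.Hom₂.comp_app, Cat.eqToHom_app]
    apply fullSub_conj
    have := M.toTwoFunctor.map₂_whisker_left f η
    rw [M.toTwoFunctor.mapComp_eq_eqToIso, M.toTwoFunctor.mapComp_eq_eqToIso] at this
    have := congrArg (fun z => z.toNatTrans.app X.obj) this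
    simp only [Cat.Hom₂.comp_app, eqToIso.hom, eqToIso.inv, Cat.eqToHom_app] at this
    exact ⟨_, _, this⟩
  map₂_whisker_right {_ _ _} {f f'} η g := by
    apply Cat.Hom₂.ext
    refine NatTrans.ext (funext fun X => ?_)
    simp only [Cat.Hom₂.comp_app, Cat.eqToHom_app]
    apply fullSub_conj
    have := M.toTwoFunctor.map₂_whisker_right η g
    rw [M.toTwoFunctor.mapComp_eq_eqToIso, M.toTwoFunctor.mapComp_eq_eqToIso] at this
    have := congrArg (fun z => z.toNatTrans.app X.obj) this
    simp only [Cat.Hom₂.comp_app, eqToIso.hom, eqToIso.inv, Cat.eqToHom_app] at this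
    exact ⟨_, _, this⟩

/-- The restriction of a 2-representation to a stable family of full subcategories. -/
def TwoRep.restrict : TwoRep.{w, v, u, t, w₁, v₁} k C where
  toTwoFunctor := StrictPseudofunctor.mk'' (restrictCore M Q hQ)
  preadditive j := inferInstanceAs (Preadditive (Q j).FullSubcategory)
  linear j := inferInstanceAs (Linear k (Q j).FullSubcategory)
  map_additive f := inferInstanceAs (restrictFunctor M Q hQ f).Additive
  map_linear f := inferInstanceAs ((restrictFunctor M Q hQ f).Linear k)
  map₂_add η θ X := ObjectProperty.hom_ext _ (M.map₂_add η θ X.obj)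
  map₂_smul a η X := ObjectProperty.hom_ext _ (M.map₂_smul a η X.obj)

end Restrict


end TwoCategories

section Fiat

open Bicategory

/-- A weak involution: the identity on objects, reversing both 1-morphisms and 2-morphisms, compatible
with composition and identities up to coherent natural isomorphisms, and with square isomorphic to
the identity. -/
structure WeakInvolution (C : Type u) [Bicategory.{w, v} C] where
  star {i j : C} : (i ⟶ j)ᵒᵖ ⥤ (j ⟶ i)
  starComp {i j l : C} (f : i ⟶ j) (g : j ⟶ l) :
    star.obj (op (f ≫ g)) ≅ star.obj (op g) ≫ star.obj (op f)
  starId (i : C) : star.obj (op (𝟙 i)) ≅ 𝟙 i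
  starStar {i j : C} (f : i ⟶ j) : star.obj (op (star.obj (op f))) ≅ f
  starComp_whiskerRight {i j l : C} {f f' : i ⟶ j} (η : f ⟶ f') (g : j ⟶ l) :
    star.map (η ▷ g).op ≫ (starComp f g).hom =
      (starComp f' g).hom ≫ star.obj (op g) ◁ star.map η.op
  starComp_whiskerLeft {i j l : C} (f : i ⟶ j) {g g' : j ⟶ l} (η : g ⟶ g') :
    star.map (f ◁ η).op ≫ (starComp f g).hom =
      (starComp f g').hom ≫ star.map η.op ▷ star.obj (op f)
  starComp_assoc {i j l m : C} (f : i ⟶ j) (g : j ⟶ l) (h : l ⟶ m) :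
    star.map (α_ f g h).hom.op ≫ (starComp (f ≫ g) h).hom ≫
        star.obj (op h) ◁ (starComp f g).hom =
      (starComp f (g ≫ h)).hom ≫ (starComp g h).hom ▷ star.obj (op f) ≫ (α_ _ _ _).hom
  starComp_id_left {i j : C} (f : i ⟶ j) :
    (starComp (𝟙 i) f).hom ≫ star.obj (op f) ◁ (starId i).hom ≫ (ρ_ _).hom =
      star.map (λ_ f).inv.op
  starComp_id_right {i j : C} (f : i ⟶ j) :
    (starComp f (𝟙 j)).hom ≫ (starId j).hom ▷ star.obj (op f) ≫ (λ_ _).hom =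
      star.map (ρ_ f).inv.op
  starStar_naturality {i j : C} {f f' : i ⟶ j} (η : f ⟶ f') :
    star.map (star.map η.op).op ≫ (starStar f').hom = (starStar f).hom ≫ η
  starStar_comp {i j l : C} (f : i ⟶ j) (g : j ⟶ l) :
    (starStar (f ≫ g)).hom =
      star.map (starComp f g).inv.op ≫ (starComp (star.obj (op g)) (star.obj (op f))).hom ≫
        (starStar f).hom ▷ star.obj (op (star.obj (op g))) ≫ f ◁ (starStar g).hom
  starStar_id (i : C) :
    (starStar (𝟙 i)).hom = star.map (starId i).inv.op ≫ (starId i).hom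

variable (k : Type t) [Field k] (C : Type u) [Bicategory.{w, v} C] [AdditiveTwoCategory C]

instance hasBinaryBiproducts_hom (i j : C) : HasBinaryBiproducts (i ⟶ j) :=
  hasBinaryBiproducts_of_finite_biproducts _

instance hasBinaryBiproducts_PBar (i j : C) : HasBinaryBiproducts (PBar i j) :=
  hasBinaryBiproducts_of_finite_biproducts _

/-- Fiat 2-categories over `k`. -/
structure IsFiat [LinearTwoCategory k C] : Prop where
  finite_objects : Finite C
  idempotentComplete (i j : C) : IsIdempotentComplete (i ⟶ j)
  finite_indecomposables (i j : C) : ∃ (n : ℕ) (e : Fin n → (i ⟶ j)),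
    ∀ f : i ⟶ j, Indecomposable f → ∃ s, Nonempty (f ≅ e s)
  finite_hom {i j : C} (f g : i ⟶ j) : Module.Finite k (f ⟶ g)
  indecomposable_id (i : C) : Indecomposable (𝟙 i)
  exists_involution : ∃ σ : WeakInvolution C, ∀ {i j : C} (f : i ⟶ j),
    Nonempty (Bicategory.Adjunction f (σ.star.obj (op f)))

end Fiat

section Categories

variable {A : Type v₁} [Category.{w₁} A]

/-- `X` is a direct summand of `Y`. -/
def IsSummand [HasZeroMorphisms A] [HasBinaryBiproducts A] (X Y : A) : Prop :=
  ∃ Z : A, Nonempty (Y ≅ X ⊞ Z)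

/-- The additive closure: direct summands of finite direct sums of objects satisfying `Q`. -/
def addClosure [HasZeroMorphisms A] [HasBinaryBiproducts A] [HasFiniteBiproducts A]
    (Q : ObjectProperty A) : ObjectProperty A := fun X =>
  ∃ (n : ℕ) (Y : Fin n → A), (∀ s, Q (Y s)) ∧ IsSummand X (⨁ Y)

/-- `M` has simple top `S`: the object `S` is simple, there is an epimorphism `p : M ⟶ S`, and every
nonzero morphism from `M` to a simple object is `p` followed by an isomorphism. -/
def HasSimpleTop [HasZeroMorphisms A] (M S : A) : Prop :=
  Simple S ∧ ∃ p : M ⟶ S, Epi p ∧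
    ∀ (T : A) (q : M ⟶ T), Simple T → q ≠ 0 → ∃ e : S ≅ T, q = p ≫ e.hom

/-- `S` is a subquotient of `M`. -/
def IsSubquotient (S M : A) : Prop :=
  ∃ (N : A) (m : N ⟶ M) (p : N ⟶ S), Mono m ∧ Epi p

/-- `CompMult S M n`: the object `M` has a composition series in which exactly `n` of the factors are
isomorphic to the simple object `S`, that is, `[M : S] = n`. -/
inductive CompMult [HasZeroMorphisms A] (S : A) : A → ℕ → Prop
  | zero {M : A} (hM : IsZero M) : CompMult S M 0
  | iso {N M T : A} {m : N ⟶ M} {p : M ⟶ T} (w : m ≫ p = 0)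
      (h : (ShortComplex.mk m p w).ShortExact) (hT : Simple T) (e : Nonempty (T ≅ S)) {n : ℕ}
      (hN : CompMult S N n) : CompMult S M (n + 1)
  | notIso {N M T : A} {m : N ⟶ M} {p : M ⟶ T} (w : m ≫ p = 0)
      (h : (ShortComplex.mk m p w).ShortExact) (hT : Simple T) (e : IsEmpty (T ≅ S)) {n : ℕ}
      (hN : CompMult S N n) : CompMult S M n

/-- Objects `M` with a presentation `X₁ ⟶ X₀ ⟶ M ⟶ 0` (that is, `M` is a cokernel of `X₁ ⟶ X₀`) with
`X₁` and `X₀` satisfying `Q`. -/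
def presentedBy [HasZeroMorphisms A] (Q : ObjectProperty A) : ObjectProperty A := fun M =>
  ∃ (X₁ X₀ : A) (a : X₁ ⟶ X₀) (p : X₀ ⟶ M) (w : a ≫ p = 0),
    Q X₁ ∧ Q X₀ ∧ Nonempty (IsColimit (CokernelCofork.ofπ p w))

variable (k : Type t) [Field k] [Preadditive A] [Linear k A]

/-- Contravariant `k`-linear functors to finite-dimensional vector spaces. -/
def finiteOpModules : ObjectProperty (Aᵒᵖ ⥤ ModuleCat.{w₁} k) := fun F =>
  F.Additive ∧
    (∀ {X Y : A} (a : k) (f : X ⟶ Y), F.map (a • f).op = a • F.map f.op) ∧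
    ∀ X, Module.Finite k (F.obj X)

/-- The category of finite-dimensional modules over the opposite of the `k`-linear category `A`. -/
abbrev OpMod (A : Type v₁) [Category.{w₁} A] [Preadditive A] [Linear k A] :=
  (finiteOpModules (A := A) k).FullSubcategory

/-- `A` is `k`-linearly equivalent to the category of finitely generated (equivalently,
finite-dimensional) modules over a finite-dimensional `k`-algebra. -/
def IsModuleCategory (A : Type v₁) [Category.{w₁} A] [Preadditive A] [Linear k A] : Prop :=
  ∃ (B : Type w₁) (_ : Ring B) (_ : Algebra k B) (e : A ≌ FGModuleCat.{w₁} B),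
    Module.Finite k B ∧ e.functor.Linear k

end Categories

section Cells

open Bicategory

variable {C : Type u} [Bicategory.{w, v} C] [AdditiveTwoCategory C]

/-- The right preorder: `f ≤ g` if `g` is a direct summand of `h ∘ f` for some `h`. -/
def LeR {i j l : C} (f : i ⟶ j) (g : i ⟶ l) : Prop :=
  ∃ h : j ⟶ l, IsSummand g (f ≫ h)

/-- `R` is a right cell: the set of all (representatives of isomorphism classes of) indecomposable
1-morphisms which are equivalent for the right preorder to a fixed indecomposable 1-morphism
starting at `i`. -/
def IsRightCell {i : C} (R : ∀ j : C, ObjectProperty (i ⟶ j)) : Prop :=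
  ∃ (l : C) (f : i ⟶ l), Indecomposable f ∧
    ∀ (j : C) (g : i ⟶ j), R j g ↔ Indecomposable g ∧ LeR f g ∧ LeR g f

/-- The projective object `P_f = (0 ⟶ f)`. -/
def PObj {i j : C} (f : i ⟶ j) : PBar i j := (RightFreyd.functor (i ⟶ j)).obj f

/-- `K` is a subobject (with inclusion `ι`) of `P_𝟙` such that all simple subquotients of `P_𝟙 / K` are
annihilated by all elements of the right cell `R`, and `K` has simple top `L`, which is not
annihilated by any element of `R`; moreover `L = L_g`, the simple top of `P_g`, with `g`
indecomposable. -/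
structure IsDuflo {i : C} (R : ∀ j : C, ObjectProperty (i ⟶ j)) {K : PBar i i}
    (ι : K ⟶ PObj (𝟙 i)) (g : i ⟶ i) (L : PBar i i) : Prop where
  mono : Mono ι
  annihilates : ∀ S : PBar i i, Simple S → IsSubquotient S (cokernel ι) →
    ∀ ⦃j : C⦄ (f : i ⟶ j), R j f → IsZero ((act f).obj S)
  indecomposable : Indecomposable g
  simpleTop_P : HasSimpleTop (PObj g) L
  simpleTop_K : HasSimpleTop K L
  not_isZero : ∀ ⦃j : C⦄ (f : i ⟶ j), R j f → ¬ IsZero ((act f).obj L)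

variable {i : C} (R : ∀ j : C, ObjectProperty (i ⟶ j)) (L : PBar i i)

/-- The objects `g L`, for `g` in the right cell `R`, in the principal 2-representation at `j`. -/
def cellObjects (j : C) : ObjectProperty (PBar i j) :=
  ObjectProperty.ofObj fun g : {g : i ⟶ j // R j g} => (act g.1).obj L

/-- The objects with a two-step presentation by objects in the additive closure of the `g L`. -/
def cellCategory (j : C) : ObjectProperty (PBar i j) :=
  presentedBy (addClosure (cellObjects R L j))

end Cells

end CellRep
end

open CellRep

/-! Since `f*` is adjoint to `f` on both sides (`IsFiat.exists_biadjoint`), every 1-morphism acts by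
an exact functor. Each `PBar i j` is equivalent to finitely generated modules over a
finite-dimensional algebra (`isFreydAbelian`), so it is abelian of finite length, and `P_f` for
indecomposable `f` is projective with local endomorphism ring, hence has a simple top.

Fix `f` in the cell. The functor `f` sends `P_𝟙` to `P_f`. Let `K` be a smallest subobject of `P_𝟙`
whose quotient is killed by `f`. Then `f K ≅ P_f`, no simple quotient of `K` is killed by `f`, and
simplicity of the top of `P_f` forces `K` to have a simple top `L`
(`exists_subobject_hasSimpleTop`). Annihilation propagates upwards along the right preorder, so the
choice of `f` is immaterial.

For every `x` above the cell, `x K ≅ P_x` (`IsDuflo.act_obj_iso`), so `x L` is a quotient of `P_x`.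
If `x L ≠ 0`, adjunction turns `P_x ⟶ x L` into a nonzero map from some `P_{y ∘ x}` to `L = L_d`, so
`x ≤ d`. Applying `f` to `P_d ↠ K` gives a split epimorphism onto `P_f`, so `d ≤ f`. Thus an
indecomposable `x` above the cell is in the cell or kills `L`, which gives (a).

The central fact is `IsDuflo.exists_factor`: every map `P_f ≅ f K ⟶ h L` factors through `f L`. By
adjunction it reduces to maps `x K ⟶ L`, which are nonzero on an indecomposable summand only if that
summand is `d`. Consequently `Hom(f L, h L) = Hom(P_f, h L)`, whose dimension counts composition
factors (b); kernels of `P_f ↠ f L` are stable under endomorphisms (c); and the `g L` behave as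
projectives for presentations by sums of such objects (`IsDuflo.exactOn`). The general comparison
`exists_presentedBy_equivalence` then yields the functor and module categories of (d) and (e),
stability in (e) being right exactness together with (a). -/

noncomputable section

namespace CellRep

/-! ### Krull–Schmidt theory in hom-finite idempotent complete categories -/

section KrullSchmidt

variable {V : Type v₁} [Category.{w₁} V] [Preadditive V]

/-- `X` is a finite direct sum of objects satisfying `Q`. -/
def IsFiniteSum [HasFiniteBiproducts V] (Q : ObjectProperty V) (X : V) : Prop :=
  ∃ (n : ℕ) (Y : Fin n → V), (∀ s, Q (Y s)) ∧ Nonempty (X ≅ ⨁ Y)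

/-- The identity of `X` is a sum of endomorphisms factoring through objects satisfying `Q`. -/
def FactorsThrough (Q : ObjectProperty V) (X : V) : Prop :=
  ∃ (n : ℕ) (Y : Fin n → V) (a : ∀ s, X ⟶ Y s) (b : ∀ s, Y s ⟶ X),
    (∀ s, Q (Y s)) ∧ ∑ s, a s ≫ b s = 𝟙 X

lemma FactorsThrough.map {W : Type v₂} [Category.{w₂} W] [Preadditive W] (F : V ⥤ W) [F.Additive]
    {Q : ObjectProperty V} {Q' : ObjectProperty W} {X : V} (h : FactorsThrough Q X) {M : W}
    (e : M ≅ F.obj X) (hF : ∀ Y, Q Y → Q' (F.obj Y)) : FactorsThrough Q' M := by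
  obtain ⟨n, Y, a, b, hY, hab⟩ := h
  refine ⟨n, fun s => F.obj (Y s), fun s => e.hom ≫ F.map (a s), fun s => F.map (b s) ≫ e.inv,
    fun s => hF _ (hY s), ?_⟩
  have : e.hom ≫ F.map (∑ s, a s ≫ b s) ≫ e.inv = 𝟙 M := by
    rw [hab, F.map_id, Category.id_comp, e.hom_inv_id]
  simpa only [Functor.map_sum, Functor.map_comp, sum_comp, comp_sum, Category.assoc] using this

section Biproducts

variable [HasFiniteBiproducts V] {Q : ObjectProperty V}

lemma IsFiniteSum.of_fintype {J : Type} [Fintype J] (Y : J → V) (hY : ∀ s, Q (Y s)) {X : V}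
    (e : X ≅ ⨁ Y) : IsFiniteSum Q X := by
  refine ⟨Fintype.card J, fun s => Y ((Fintype.equivFin J).symm s), fun s => hY _, ⟨e ≪≫ ?_⟩⟩
  exact biproduct.whiskerEquiv (Fintype.equivFin J) (fun j => eqToIso (by simp))

lemma IsFiniteSum.of_iso {X X' : V} (h : IsFiniteSum Q X) (e : X' ≅ X) : IsFiniteSum Q X' := by
  obtain ⟨n, Y, hY, ⟨e'⟩⟩ := h
  exact ⟨n, Y, hY, ⟨e ≪≫ e'⟩⟩

lemma IsFiniteSum.of_isZero {X : V} (h : IsZero X) : IsFiniteSum Q X := by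
  refine ⟨0, Fin.elim0, fun s => s.elim0, ⟨h.iso ?_⟩⟩
  rw [IsZero.iff_id_eq_zero]
  exact biproduct.hom_ext' _ _ fun s => s.elim0

lemma IsFiniteSum.of_prop {X : V} (h : Q X) : IsFiniteSum Q X := by
  refine IsFiniteSum.of_fintype (J := Unit) (fun _ => X) (fun _ => h) ?_
  exact (biproductUniqueIso (fun _ : Unit => X)).symm

lemma IsFiniteSum.biproduct {J : Type} [Fintype J] {X : J → V} (h : ∀ s, IsFiniteSum Q (X s)) :
    IsFiniteSum Q (⨁ X) := by
  choose n Y hY e using h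
  refine IsFiniteSum.of_fintype (J := Σ j : J, Fin (n j)) (fun j => Y j.1 j.2)
    (fun s => hY _ _) ?_
  exact biproduct.mapIso (fun j => (e j).some) ≪≫
    biproductBiproductIso (fun j => Fin (n j)) (fun j s => Y j s)

lemma biprod_iso_biproduct_cond {X Y : V} [HasBinaryBiproducts V] :
    Nonempty (X ⊞ Y ≅ ⨁ (fun b : Bool => cond b X Y)) := by
  refine ⟨⟨biprod.desc (biproduct.ι (fun b : Bool => cond b X Y) true)
      (biproduct.ι (fun b : Bool => cond b X Y) false),
    biprod.lift (biproduct.π (fun b : Bool => cond b X Y) true)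
      (biproduct.π (fun b : Bool => cond b X Y) false), ?_, ?_⟩⟩
  · apply biprod.hom_ext' <;> apply biprod.hom_ext <;>
      simp
  · rw [biprod.lift_desc, ← biproduct.total]
    simp

lemma IsFiniteSum.biprod {X Y : V} [HasBinaryBiproducts V] (hX : IsFiniteSum Q X)
    (hY : IsFiniteSum Q Y) : IsFiniteSum Q (X ⊞ Y) :=
  (IsFiniteSum.biproduct (X := fun b : Bool => cond b X Y)
    (by rintro (_ | _) <;> assumption)).of_iso biprod_iso_biproduct_cond.some

lemma IsFiniteSum.map {W : Type v₂} [Category.{w₂} W] [Preadditive W] [HasFiniteBiproducts W]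
    (F : V ⥤ W) [F.Additive] {Q' : ObjectProperty W} {X : V} (h : IsFiniteSum Q X)
    (hF : ∀ Y, Q Y → IsFiniteSum Q' (F.obj Y)) : IsFiniteSum Q' (F.obj X) := by
  obtain ⟨n, Y, hY, ⟨e⟩⟩ := h
  exact (IsFiniteSum.biproduct (fun s => hF _ (hY s))).of_iso
    (F.mapIso e ≪≫ F.mapBiproduct Y)

lemma IsFiniteSum.exists_retracts {X : V} (h : IsFiniteSum Q X) :
    ∃ (n : ℕ) (Y : Fin n → V) (a : ∀ s, X ⟶ Y s) (b : ∀ s, Y s ⟶ X),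
      (∀ s, Q (Y s)) ∧ (∀ s, b s ≫ a s = 𝟙 (Y s)) ∧ ∑ s, a s ≫ b s = 𝟙 X := by
  obtain ⟨n, Y, hY, ⟨e⟩⟩ := h
  refine ⟨n, Y, fun s => e.hom ≫ biproduct.π Y s, fun s => biproduct.ι Y s ≫ e.inv, hY,
    fun s => by simp, ?_⟩
  have : e.hom ≫ (∑ s, biproduct.π Y s ≫ biproduct.ι Y s) ≫ e.inv = 𝟙 X := by
    rw [biproduct.total]; simp
  simpa only [sum_comp, comp_sum, Category.assoc] using this

lemma addClosure_of_isFiniteSum [HasBinaryBiproducts V] {X : V} (h : IsFiniteSum Q X) :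
    addClosure Q X := by
  obtain ⟨n, Y, hY, ⟨e⟩⟩ := h
  refine ⟨n, Y, hY, ⨁ (Fin.elim0 : Fin 0 → V), ⟨e.symm ≪≫ ?_⟩⟩
  have hz : IsZero (⨁ (Fin.elim0 : Fin 0 → V)) := by
    rw [IsZero.iff_id_eq_zero]
    exact biproduct.hom_ext' _ _ fun s => s.elim0
  exact ⟨biprod.inl, biprod.fst, by simp, by
    apply biprod.hom_ext'
    · simp
    · exact hz.eq_of_src _ _⟩

lemma factorsThrough_of_addClosure [HasBinaryBiproducts V] {X : V} (h : addClosure Q X) :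
    FactorsThrough Q X := by
  obtain ⟨n, Y, hY, Z, ⟨e⟩⟩ := h
  refine ⟨n, Y, fun s => biprod.inl ≫ e.inv ≫ biproduct.π Y s,
    fun s => biproduct.ι Y s ≫ e.hom ≫ biprod.fst, hY, ?_⟩
  have : biprod.inl ≫ e.inv ≫ (∑ s, biproduct.π Y s ≫ biproduct.ι Y s) ≫ e.hom ≫ biprod.fst
      = 𝟙 X := by
    rw [biproduct.total]; simp
  simpa only [sum_comp, comp_sum, Category.assoc] using this

lemma FactorsThrough.of_representatives {n : ℕ} {r : Fin n → V}
    (hr : ∀ Y, Q Y → ∃ s, Nonempty (Y ≅ r s)) {X : V} (h : FactorsThrough Q X) :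
    FactorsThrough (fun Y => Y = ⨁ r) X := by
  obtain ⟨m, Y, a, b, hY, hab⟩ := h
  choose s φ using fun t => hr (Y t) (hY t)
  refine ⟨m, fun _ => ⨁ r, fun t => a t ≫ (φ t).some.hom ≫ biproduct.ι r (s t),
    fun t => biproduct.π r (s t) ≫ (φ t).some.inv ≫ b t, fun _ => rfl, ?_⟩
  rw [← hab]
  exact Finset.sum_congr rfl fun t _ => by simp

lemma addClosure_map {W : Type v₂} [Category.{w₂} W] [Preadditive W] [HasFiniteBiproducts W]
    [HasBinaryBiproducts V] [HasBinaryBiproducts W]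
    (F : V ⥤ W) [F.Additive] {Q' : ObjectProperty W} {X : V} (h : addClosure Q X)
    (hF : ∀ Y, Q Y → IsFiniteSum Q' (F.obj Y)) : addClosure Q' (F.obj X) := by
  obtain ⟨n, Y, hY, Z, ⟨e⟩⟩ := h
  obtain ⟨m, Y', hY', ⟨e'⟩⟩ :=
    IsFiniteSum.map (Q := Q) F ⟨n, Y, hY, ⟨Iso.refl _⟩⟩ hF
  have : PreservesBinaryBiproducts F := preservesBinaryBiproducts_of_preservesBiproducts F
  exact ⟨m, Y', hY', F.obj Z, ⟨e'.symm ≪≫ F.mapIso e ≪≫ F.mapBiprod X Z⟩⟩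

end Biproducts

lemma isSummand_of_retract [IsIdempotentComplete V] [HasBinaryBiproducts V] {X Y : V}
    (s : X ⟶ Y) (r : Y ⟶ X) (h : s ≫ r = 𝟙 X) : IsSummand X Y := by
  -- The complement of `X` is the image of the complementary idempotent.
  obtain ⟨Z, i, q, hiq, hqi⟩ := IsIdempotentComplete.idempotents_split Y (𝟙 Y - r ≫ s)
    (by simp [sub_comp, comp_sub, reassoc_of% h])
  have hsq : s ≫ q = 0 := by
    have : s ≫ q ≫ i ≫ q = 0 := by
      rw [reassoc_of% hqi]; simp [reassoc_of% h]
    simpa [hiq] using this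
  have hir : i ≫ r = 0 := by
    have : i ≫ (q ≫ i) ≫ r = 0 := by
      rw [hqi]; simp [sub_comp, h]
    simpa [reassoc_of% hiq] using this
  refine ⟨Z, ⟨⟨biprod.lift r q, biprod.desc s i, ?_, ?_⟩⟩⟩
  · rw [biprod.lift_desc, hqi]; simp
  · apply biprod.hom_ext' <;> apply biprod.hom_ext <;> simp [h, hsq, hir, hiq]

lemma IsSummand.exists_retract [HasBinaryBiproducts V] {X Y : V} (h : IsSummand X Y) :
    ∃ (s : X ⟶ Y) (r : Y ⟶ X), s ≫ r = 𝟙 X := by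
  obtain ⟨Z, ⟨e⟩⟩ := h
  exact ⟨biprod.inl ≫ e.inv, e.hom ≫ biprod.fst, by simp⟩

variable (k : Type t) [Field k] [Linear k V]

/-- Block-diagonal endomorphisms inject. Together with `finrank_end_pos`, this makes the dimension
of the endomorphism space drop strictly on passing to the factors of a proper decomposition, which
is the induction measure for splitting into indecomposables. -/
lemma finrank_end_biprod_le [HasBinaryBiproducts V]
    (hfin : ∀ X Y : V, Module.Finite k (X ⟶ Y)) (X Y : V) :
    Module.finrank k (X ⟶ X) + Module.finrank k (Y ⟶ Y) ≤
      Module.finrank k ((X ⊞ Y) ⟶ (X ⊞ Y)) := by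
  have := hfin
  let f : ((X ⟶ X) × (Y ⟶ Y)) →ₗ[k] ((X ⊞ Y) ⟶ (X ⊞ Y)) :=
    { toFun := fun p => biprod.map p.1 p.2
      map_add' := fun p q => by apply biprod.hom_ext' <;> simp
      map_smul' := fun a p => by apply biprod.hom_ext' <;> simp }
  rw [← Module.finrank_prod]
  refine LinearMap.finrank_le_finrank_of_injective (f := f) fun p q h => ?_
  have h1 := congrArg (fun z => biprod.inl ≫ z ≫ biprod.fst) h
  have h2 := congrArg (fun z => biprod.inr ≫ z ≫ biprod.snd) h
  simp only [f, LinearMap.coe_mk, AddHom.coe_mk, biprod.map_fst, biprod.map_snd,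
    biprod.inl_fst_assoc, biprod.inr_snd_assoc] at h1 h2
  exact Prod.ext h1 h2

lemma finrank_end_eq_of_iso {X Y : V} (e : X ≅ Y) :
    Module.finrank k (X ⟶ X) = Module.finrank k (Y ⟶ Y) :=
  LinearEquiv.finrank_eq
    { toFun := fun f => e.inv ≫ f ≫ e.hom
      invFun := fun f => e.hom ≫ f ≫ e.inv
      map_add' := by simp
      map_smul' := by simp
      left_inv := fun f => by simp
      right_inv := fun f => by simp }

lemma finrank_end_pos (hfin : ∀ X Y : V, Module.Finite k (X ⟶ Y)) {X : V} (hX : ¬ IsZero X) :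
    0 < Module.finrank k (X ⟶ X) := by
  have := hfin
  have : Nontrivial (X ⟶ X) := ⟨𝟙 X, 0, fun h => hX ((IsZero.iff_id_eq_zero X).2 h)⟩
  exact Module.finrank_pos

/-- Existence of decompositions into indecomposable objects. -/
lemma isFiniteSum_indecomposable [HasFiniteBiproducts V] [HasBinaryBiproducts V]
    (hfin : ∀ X Y : V, Module.Finite k (X ⟶ Y)) (X : V) :
    IsFiniteSum (fun Y : V => Indecomposable Y) X := by
  induction hd : Module.finrank k (X ⟶ X) using Nat.strong_induction_on generalizing X with
  | _ d ih =>
    by_cases hz : IsZero X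
    · exact .of_isZero hz
    by_cases hi : Indecomposable X
    · exact .of_prop hi
    have : ∃ Y Z, ∃ _ : X ≅ Y ⊞ Z, ¬ IsZero Y ∧ ¬ IsZero Z := by
      by_contra! hcon
      exact hi ⟨hz, fun Y Z e => or_iff_not_imp_left.2 fun hY => hcon Y Z e hY⟩
    obtain ⟨Y, Z, e, hY, hZ⟩ := this
    have h1 := finrank_end_biprod_le k hfin Y Z
    rw [← finrank_end_eq_of_iso k e, hd] at h1
    have h2 := finrank_end_pos k hfin hY
    have h3 := finrank_end_pos k hfin hZ
    exact ((ih _ (by omega) Y rfl).biprod (ih _ (by omega) Z rfl)).of_iso e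

/-- In a hom-finite category, an endomorphism with a one-sided inverse is invertible. -/
lemma isIso_of_left_inverse (hfin : ∀ X Y : V, Module.Finite k (X ⟶ Y)) {X : V} {a b : X ⟶ X}
    (h : b ≫ a = 𝟙 X) : IsIso a := by
  have := hfin
  have hinj : Function.Injective (Linear.rightComp k X b) := by
    intro x y hxy
    have := congrArg (fun z => z ≫ a) hxy
    simpa [h] using this
  obtain ⟨c, hc⟩ := LinearMap.surjective_of_injective hinj (𝟙 X)
  have hc : c ≫ b = 𝟙 X := hc
  have : c = a := by
    have := congrArg (fun z => z ≫ a) hc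
    simpa [h] using this
  exact ⟨b, this ▸ hc, h⟩

/-- Fitting's lemma: an endomorphism `a` of an indecomposable object is invertible, or
`1 - a` is. -/
lemma isIso_or_isIso_one_sub [IsIdempotentComplete V] [HasBinaryBiproducts V]
    (hfin : ∀ X Y : V, Module.Finite k (X ⟶ Y)) {X : V} (hX : Indecomposable X) (a : X ⟶ X) :
    IsIso a ∨ IsIso (𝟙 X - a) := by
  have := hfin
  -- Splitting both `e` and `𝟙 X - e` decomposes `X`, and indecomposability kills one of the two
  -- images.
  have idem : ∀ e : X ⟶ X, e ≫ e = e → e = 0 ∨ e = 𝟙 X := by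
    intro e he
    obtain ⟨Y, i, q, hiq, hqi⟩ := IsIdempotentComplete.idempotents_split X e he
    obtain ⟨Z, j, r, hjr, hrj⟩ := IsIdempotentComplete.idempotents_split X (𝟙 X - e)
      (by simp [sub_comp, comp_sub, he])
    have hir : i ≫ r = 0 := by
      have : i ≫ (q ≫ i) ≫ (r ≫ j) ≫ r = 0 := by
        rw [hqi, hrj]; simp [sub_comp, comp_sub, reassoc_of% he]
      simpa [reassoc_of% hiq, hjr] using this
    have hjq : j ≫ q = 0 := by
      have : j ≫ (r ≫ j) ≫ (q ≫ i) ≫ q = 0 := by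
        rw [hqi, hrj]; simp [sub_comp, reassoc_of% he]
      simpa [reassoc_of% hjr, hiq] using this
    let φ : X ≅ Y ⊞ Z := ⟨biprod.lift q r, biprod.desc i j, by
        rw [biprod.lift_desc, hqi, hrj]; simp, by
        apply biprod.hom_ext' <;> apply biprod.hom_ext <;> simp [hiq, hjr, hir, hjq]⟩
    rcases hX.2 Y Z φ with h | h
    · left; rw [← hqi, h.eq_of_tgt q 0, zero_comp]
    · right
      have : 𝟙 X - e = 0 := by rw [← hrj, h.eq_of_tgt r 0, zero_comp]
      exact (sub_eq_zero.1 this).symm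
  let T : Module.End k (X ⟶ X) := Linear.rightComp k X a
  -- Here `T` is postcomposition with `a`. The requirement `1 ≤ n` allows one factor `a` to be split
  -- off in the last case.
  obtain ⟨n, hn, hn1⟩ := ((LinearMap.eventually_isCompl_ker_pow_range_pow T).and
    (Filter.eventually_ge_atTop 1)).exists
  obtain ⟨y, hy, z, hz, hyz⟩ := Submodule.mem_sup.1
    (hn.sup_eq_top.ge (Submodule.mem_top (x := 𝟙 X)))
  have hT : ∀ (m : ℕ) (x y : X ⟶ X), (T ^ m) (x ≫ y) = x ≫ (T ^ m) y := by
    intro m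
    induction m with
    | zero => simp
    | succ m ih =>
      intro x y
      rw [pow_succ, Module.End.mul_apply, Module.End.mul_apply, ← ih]
      simp [T]
  have hker : ∀ x y, y ∈ LinearMap.ker (T ^ n) → x ≫ y ∈ LinearMap.ker (T ^ n) := by
    intro x y hy; rw [LinearMap.mem_ker] at *; rw [hT, hy, comp_zero]
  have hran : ∀ x y, y ∈ LinearMap.range (T ^ n) → x ≫ y ∈ LinearMap.range (T ^ n) := by
    rintro x y ⟨w, rfl⟩; exact ⟨x ≫ w, hT _ _ _⟩
  -- Kernel and range of `T ^ n` are both stable under precomposition, so this element lies in their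
  -- intersection and vanishes. Hence `z` is idempotent: `z = 0` makes `a` nilpotent, and `z = 𝟙 X`
  -- gives `a` a one-sided inverse.
  have hzy : z ≫ y = z - z ≫ z := by
    rw [eq_sub_iff_add_eq, ← comp_add, hyz, Category.comp_id]
  have hzy0 : z ≫ y = 0 := by
    have h : z ≫ y ∈ LinearMap.ker (T ^ n) ⊓ LinearMap.range (T ^ n) :=
      ⟨hker z y hy, hzy ▸ Submodule.sub_mem _ hz (hran z z hz)⟩
    rwa [hn.inf_eq_bot, Submodule.mem_bot] at h
  rcases idem z (sub_eq_zero.1 (hzy.symm.trans hzy0)).symm with h | h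
  · right
    have hpow : ∀ m : ℕ, (T ^ m) (𝟙 X) = ((End.of a) ^ m : End X) := by
      intro m
      induction m with
      | zero => rfl
      | succ m ih => rw [pow_succ', Module.End.mul_apply, ih, pow_succ']; rfl
    have hy1 : y = 𝟙 X := by rw [← hyz, h, add_zero]
    have hnil : IsNilpotent (End.of a) :=
      ⟨n, by rw [← hpow n, ← hy1]; exact hy⟩
    exact (isUnit_iff_isIso _).1 hnil.isUnit_one_sub
  · left
    obtain ⟨b, hb⟩ := hz
    obtain ⟨m, rfl⟩ : ∃ m, n = m + 1 := ⟨n - 1, by omega⟩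
    rw [pow_succ', Module.End.mul_apply, h] at hb
    exact isIso_of_left_inverse k hfin hb

end KrullSchmidt

/-! ### Comparing categories of finitely presented objects -/

section Presentations

variable {A : Type v₁} [Category.{w₁} A] [Preadditive A]
variable {T : Type v₂} [Category.{w₂} T] [Preadditive T]

lemma presentedBy_of_prop (Q : ObjectProperty A) {X : A} (hX : Q X) : presentedBy Q X := by
  refine ⟨X, X, 0, 𝟙 X, zero_comp, hX, hX, ⟨?_⟩⟩
  exact CokernelCofork.IsColimit.ofπ' _ _ fun g _ => ⟨g, Category.id_comp g⟩

/-- The functor `H` carries presentations by objects satisfying `Q` to presentations. -/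
def PreservesPresentations (H : A ⥤ T) [H.Additive] (Q : ObjectProperty A) : Prop :=
  ∀ ⦃X₁ X₀ M : A⦄ (a : X₁ ⟶ X₀) (p : X₀ ⟶ M) (w : a ≫ p = 0), Q X₁ → Q X₀ →
    Nonempty (IsColimit (CokernelCofork.ofπ p w)) →
    Nonempty (IsColimit (CokernelCofork.ofπ (f := H.map a) (H.map p)
      (by rw [← H.map_comp, w, H.map_zero])))

lemma lift_linear (H : A ⥤ T) (k : Type t) [Field k] [Linear k A] [Linear k T] [H.Linear k]
    (P : ObjectProperty T) (R : ObjectProperty A) (h : ∀ X : R.FullSubcategory, P (H.obj X.obj)) :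
    (P.lift (R.ι ⋙ H) h).Linear k where
  map_smul f a := ObjectProperty.hom_ext _ (H.map_smul a f.hom)

variable (H : A ⥤ T) [H.Additive] (Q : ObjectProperty A)

/-- A morphism out of a cokernel of `X₁ ⟶ X₀` is a morphism out of `X₀` vanishing on `X₁`, on both
sides of `H`; full faithfulness on sources satisfying `Q` therefore extends to all presented
sources. -/
lemma map_bijective_of_presentedBy
    (hH : ∀ ⦃X M : A⦄, Q X → presentedBy Q M →
      Function.Bijective (H.map : (X ⟶ M) → (H.obj X ⟶ H.obj M)))
    (hQ : PreservesPresentations H Q) {M N : A} (hM : presentedBy Q M) (hN : presentedBy Q N) :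
    Function.Bijective (H.map : (M ⟶ N) → (H.obj M ⟶ H.obj N)) := by
  obtain ⟨X₁, X₀, a, p, w, h₁, h₀, ⟨hp⟩⟩ := hM
  obtain ⟨hHp⟩ := hQ a p w h₁ h₀ ⟨hp⟩
  have ep : Epi p := ⟨fun f g h => Cofork.IsColimit.hom_ext hp h⟩
  have eHp : Epi (H.map p) := ⟨fun f g h => Cofork.IsColimit.hom_ext hHp h⟩
  constructor
  · intro f g hfg
    rw [← cancel_epi p]
    apply (hH h₀ hN).1
    rw [H.map_comp, hfg, H.map_comp]
  · intro φ
    obtain ⟨b, hb⟩ := (hH h₀ hN).2 (H.map p ≫ φ)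
    have hab : a ≫ b = 0 := by
      apply (hH h₁ hN).1
      rw [H.map_comp, hb, ← H.map_comp_assoc, w, H.map_zero, H.map_zero, zero_comp]
    refine ⟨hp.desc (CokernelCofork.ofπ b hab), ?_⟩
    rw [← cancel_epi (H.map p), ← H.map_comp, ← hb]
    congr 1
    exact hp.fac (CokernelCofork.ofπ b hab) WalkingParallelPair.one

/-- Lift the relation map `b` along `H` and take its cokernel in `A`; `H` preserves that
presentation. -/
lemma exists_presentedBy_iso [HasCokernels A]
    (hH : ∀ ⦃X M : A⦄, Q X → presentedBy Q M →
      Function.Bijective (H.map : (X ⟶ M) → (H.obj X ⟶ H.obj M)))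
    (hQ : PreservesPresentations H Q) {X₁ X₀ : A} (h₁ : Q X₁) (h₀ : Q X₀) {N : T}
    (b : H.obj X₁ ⟶ H.obj X₀) (π : H.obj X₀ ⟶ N) (w : b ≫ π = 0)
    (hπ : IsColimit (CokernelCofork.ofπ π w)) :
    ∃ M, presentedBy Q M ∧ Nonempty (H.obj M ≅ N) := by
  obtain ⟨a, rfl⟩ := (hH h₁ (presentedBy_of_prop Q h₀)).2 b
  have hc : IsColimit (CokernelCofork.ofπ (cokernel.π a) (cokernel.condition a)) :=
    cokernelIsCokernel a
  refine ⟨cokernel a, ⟨X₁, X₀, a, cokernel.π a, cokernel.condition a, h₁, h₀, ⟨hc⟩⟩, ?_⟩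
  obtain ⟨h⟩ := hQ a (cokernel.π a) (cokernel.condition a) h₁ h₀ ⟨hc⟩
  exact ⟨h.coconePointUniqueUpToIso hπ⟩

/-- The common mechanism behind the equivalences with modules and with functor categories. The
formula for `e.functor` is recorded so that its linearity can be deduced afterwards. -/
lemma exists_presentedBy_equivalence
    (hH : ∀ ⦃X M : A⦄, Q X → presentedBy Q M →
      Function.Bijective (H.map : (X ⟶ M) → (H.obj X ⟶ H.obj M)))
    (hQ : PreservesPresentations H Q) (P : ObjectProperty T)
    (hP : ∀ M, presentedBy Q M → P (H.obj M))
    (hsurj : ∀ N, P N → ∃ M, presentedBy Q M ∧ Nonempty (H.obj M ≅ N)) :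
    ∃ e : (presentedBy Q).FullSubcategory ≌ P.FullSubcategory,
      e.functor = P.lift ((presentedBy Q).ι ⋙ H) (fun X => hP _ X.property) := by
  let F := P.lift ((presentedBy Q).ι ⋙ H) (fun X => hP _ X.property)
  have hb := fun (X Y : (presentedBy Q).FullSubcategory) =>
    map_bijective_of_presentedBy H Q hH hQ X.property Y.property
  have : F.Faithful := ⟨fun {X Y} f g h => ObjectProperty.hom_ext _
    ((hb X Y).1 (congrArg (fun z => z.hom) h))⟩
  have : F.Full := ⟨fun {X Y} f => by
    obtain ⟨g, hg⟩ := (hb X Y).2 f.hom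
    exact ⟨ObjectProperty.homMk g, ObjectProperty.hom_ext _ hg⟩⟩
  have : F.EssSurj := ⟨fun N => by
    obtain ⟨M, hM, ⟨e⟩⟩ := hsurj N.obj N.property
    exact ⟨⟨M, hM⟩, ⟨P.isoMk e⟩⟩⟩
  have : F.IsEquivalence := {}
  exact ⟨F.asEquivalence, rfl⟩

end Presentations

/-! ### Equivalence with modules over an endomorphism algebra -/

section Modules

variable {A : Type v₁} [Category.{w₁} A] [Preadditive A]

/-- `Hom(G, -)` is exact on the presentation `a, p`. -/
def ExactOn (G : A) {X₁ X₀ M : A} (a : X₁ ⟶ X₀) (p : X₀ ⟶ M) : Prop :=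
  (∀ f : G ⟶ M, ∃ g : G ⟶ X₀, g ≫ p = f) ∧
    ∀ g : G ⟶ X₀, g ≫ p = 0 → ∃ h : G ⟶ X₁, h ≫ a = g

lemma ExactOn.biproduct [HasFiniteBiproducts A] {n : ℕ} {G : Fin n → A} {X₁ X₀ M : A}
    {a : X₁ ⟶ X₀} {p : X₀ ⟶ M} (h : ∀ s, ExactOn (G s) a p) : ExactOn (⨁ G) a p := by
  constructor
  · intro f
    choose g hg using fun s => (h s).1 (biproduct.ι G s ≫ f)
    exact ⟨biproduct.desc g, biproduct.hom_ext' _ _ fun s => by simp [hg]⟩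
  · intro g hg
    choose c hc using fun s => (h s).2 (biproduct.ι G s ≫ g) (by rw [Category.assoc, hg, comp_zero])
    exact ⟨biproduct.desc c, biproduct.hom_ext' _ _ fun s => by simp [hc]⟩

lemma moduleCat_isColimit {B : Type u} [Ring B] {X Y Z : ModuleCat.{v} B} (f : X ⟶ Y) (g : Y ⟶ Z)
    (w : f ≫ g = 0) (hg : Function.Surjective g) (hf : ∀ y, g y = 0 → ∃ x, f x = y) :
    Nonempty (IsColimit (CokernelCofork.ofπ g w)) := by
  have : Epi g := (ModuleCat.epi_iff_surjective g).2 hg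
  exact ⟨((ShortComplex.moduleCat_exact_iff (ShortComplex.mk f g w)).2 hf).gIsCokernel⟩

variable (G : A) (Q : ObjectProperty A)

/-- The maps `a s`, `b s` act as a dual basis of `Hom(G, X)`: a module map is determined by its
values on the `b s`, and `∑ s, a s ≫ φ (b s)` recovers the morphism. -/
lemma coyonedaObj_bijective {X : A} (hX : FactorsThrough (fun Y => Y = G) X) (M : A) :
    Function.Bijective ((preadditiveCoyonedaObj G).map :
      (X ⟶ M) → ((preadditiveCoyonedaObj G).obj X ⟶ (preadditiveCoyonedaObj G).obj M)) := by
  obtain ⟨n, Y, a, b, hY, hab⟩ := hX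
  obtain rfl : Y = fun _ => G := funext hY
  constructor
  · intro f g h
    rw [← Category.id_comp f, ← Category.id_comp g, ← hab, sum_comp, sum_comp]
    refine Finset.sum_congr rfl fun s _ => ?_
    rw [Category.assoc, Category.assoc]
    exact congrArg (fun z => a s ≫ z) (congrArg (fun z => z.hom (b s)) h)
  · intro φ
    let φ' : (G ⟶ X) →ₗ[(End G)ᵐᵒᵖ] (G ⟶ M) := φ.hom
    refine ⟨∑ s, a s ≫ φ' (b s), ?_⟩
    apply ModuleCat.hom_ext
    apply LinearMap.ext
    intro (g : G ⟶ X)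
    -- The composite `g ≫ a s` is an endomorphism of `G`, so this is linearity of `φ'` over the
    -- endomorphism ring.
    have h1 : ∀ s, g ≫ a s ≫ φ' (b s) = φ' (g ≫ a s ≫ b s) := fun s => by
      have := φ'.map_smul (MulOpposite.op (End.of (g ≫ a s))) (b s)
      refine Eq.trans ?_ (this.symm.trans (congrArg φ' ?_))
      · exact (Category.assoc _ _ _).symm
      · exact Category.assoc _ _ _
    have h2 : g ≫ ∑ s, a s ≫ φ' (b s) = φ' g := by
      rw [comp_sum, Finset.sum_congr rfl (fun s _ => h1 s), ← map_sum, ← comp_sum, hab,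
        Category.comp_id]
    exact h2

variable (k : Type t) [Field k] [Linear k A]

instance coyonedaObj_linear : (preadditiveCoyonedaObj G).Linear k where
  map_smul {X Y} f r := by
    apply ModuleCat.hom_ext
    apply LinearMap.ext
    intro (g : G ⟶ X)
    change g ≫ (r • f) = (r • 𝟙 G) ≫ g ≫ f
    simp

lemma finite_end_op (hfin : ∀ X Y : A, Module.Finite k (X ⟶ Y)) :
    Module.Finite k (End G)ᵐᵒᵖ := by
  have : Module.Finite k (End G) := hfin G G
  exact Module.Finite.equiv (MulOpposite.opLinearEquiv k)

lemma isFG_coyonedaObj (hfin : ∀ X Y : A, Module.Finite k (X ⟶ Y)) (X : A) :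
    ModuleCat.isFG _ ((preadditiveCoyonedaObj G).obj X) := by
  have := hfin G X
  have : IsScalarTower k (End G)ᵐᵒᵖ (G ⟶ X) := ⟨fun r b m => by
    change (r • b.unop) ≫ m = r • (b.unop ≫ m)
    exact Linear.smul_comp _ _ _ _ _ _⟩
  exact Module.Finite.of_restrictScalars_finite k (End G)ᵐᵒᵖ (G ⟶ X)

/-- Objects presented by direct summands of powers of `G`, on which `Hom(G, -)` is exact, form
a category equivalent to the finitely generated modules over the opposite of `End G`. -/
lemma exists_equivalence_fgModuleCat [HasCokernels A] [HasFiniteBiproducts A]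
    (hfin : ∀ X Y : A, Module.Finite k (X ⟶ Y))
    (hQ : ∀ X, Q X → FactorsThrough (fun Y => Y = G) X)
    (hG : ∀ n : ℕ, Q (⨁ fun _ : Fin n => G))
    (hex : ∀ ⦃X₁ X₀ M : A⦄ (a : X₁ ⟶ X₀) (p : X₀ ⟶ M) (w : a ≫ p = 0), Q X₁ → Q X₀ →
      Nonempty (IsColimit (CokernelCofork.ofπ p w)) → ExactOn G a p) :
    ∃ e : (presentedBy Q).FullSubcategory ≌ FGModuleCat.{w₁} (End G)ᵐᵒᵖ,
      e.functor.Linear k := by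
  have hpres : PreservesPresentations (preadditiveCoyonedaObj G) Q := by
    intro X₁ X₀ M a p w h₁ h₀ hp
    obtain ⟨hl, he⟩ := hex a p w h₁ h₀ hp
    exact moduleCat_isColimit _ _ _ hl he
  have hB := fun (X M : A) (hX : Q X) (_ : presentedBy Q M) => coyonedaObj_bijective G (hQ X hX) M
  have := finite_end_op G k hfin
  have : IsNoetherianRing (End G)ᵐᵒᵖ := isNoetherian_of_tower k inferInstance
  obtain ⟨e, he⟩ := exists_presentedBy_equivalence (preadditiveCoyonedaObj G) Q hB hpres
    (ModuleCat.isFG _) (fun M _ => isFG_coyonedaObj G k hfin M) (by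
      intro N hN
      have hN : Module.Finite (End G)ᵐᵒᵖ N := hN
      obtain ⟨n, x, hx⟩ := Submodule.fg_iff_exists_fin_generating_family.1 hN.fg_top
      let P : A := ⨁ fun _ : Fin n => G
      -- The free cover of `N` given by the generators `x`, with `Hom(G, Gⁿ)` as the free module.
      let ψ : (G ⟶ P) →ₗ[(End G)ᵐᵒᵖ] N :=
        { toFun := fun u => ∑ s, MulOpposite.op (End.of (u ≫ biproduct.π _ s)) • x s
          map_add' := fun u v => by
            rw [← Finset.sum_add_distrib]
            refine Finset.sum_congr rfl fun s _ => ?_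
            rw [add_comp]
            exact add_smul _ _ _
          map_smul' := fun r u => by
            rw [Finset.smul_sum]
            refine Finset.sum_congr rfl fun s _ => ?_
            rw [RingHom.id_apply, smul_smul]
            congr 1
            exact congrArg MulOpposite.op (Category.assoc _ _ _) }
      have hψ : Function.Surjective ψ := fun y => by
        obtain ⟨c, rfl⟩ := (Submodule.mem_span_range_iff_exists_fun _).1
          (hx.ge (Submodule.mem_top (x := y)))
        refine ⟨biproduct.lift fun s => (c s).unop, ?_⟩
        change ∑ s, MulOpposite.op (End.of (biproduct.lift _ ≫ biproduct.π _ s)) • x s = _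
        refine Finset.sum_congr rfl fun s _ => ?_
        rw [biproduct.lift_π]
        rfl
      have hP : Module.Finite (End G)ᵐᵒᵖ (G ⟶ P) := isFG_coyonedaObj G k hfin P
      -- By noetherianity the relations are finitely generated. Their generators are maps `G ⟶ P`,
      -- which assemble to the relation map `d`.
      obtain ⟨m, z, hz⟩ := Submodule.fg_iff_exists_fin_generating_family.1
        (IsNoetherian.noetherian (LinearMap.ker ψ))
      have hzψ : ∀ s, ψ (z s) = 0 := fun s => LinearMap.mem_ker.1
        (hz ▸ Submodule.subset_span (Set.mem_range_self s))
      let d : (⨁ fun _ : Fin m => G) ⟶ P := biproduct.desc z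
      have hd : ∀ u : G ⟶ ⨁ fun _ : Fin m => G,
          u ≫ d = ∑ s, MulOpposite.op (End.of (u ≫ biproduct.π _ s)) • z s := fun u => by
        conv_lhs => rw [← Category.comp_id u, ← biproduct.total, comp_sum, sum_comp]
        refine Finset.sum_congr rfl fun s _ => ?_
        simp only [d, Category.assoc, biproduct.ι_desc]
        exact (Category.assoc _ _ _).symm
      have hdψ : (preadditiveCoyonedaObj G).map d ≫ ModuleCat.ofHom ψ = 0 := by
        apply ModuleCat.hom_ext
        apply LinearMap.ext
        intro (u : G ⟶ _)
        change ψ (u ≫ d) = 0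
        rw [hd, map_sum]
        exact Finset.sum_eq_zero fun s _ => by rw [map_smul, hzψ, smul_zero]
      refine exists_presentedBy_iso (preadditiveCoyonedaObj G) Q hB hpres (hG m) (hG n)
        ((preadditiveCoyonedaObj G).map d) (ModuleCat.ofHom ψ) hdψ
        (moduleCat_isColimit _ _ hdψ hψ ?_).some
      · intro (y : G ⟶ P) hy
        obtain ⟨c, rfl⟩ := (Submodule.mem_span_range_iff_exists_fun _).1
          (hz.ge (LinearMap.mem_ker.2 hy))
        refine ⟨biproduct.lift fun s => (c s).unop, (hd _).trans
          (Finset.sum_congr rfl fun s _ => ?_)⟩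
        rw [biproduct.lift_π]
        rfl)
  exact ⟨e, he ▸ lift_linear _ k _ _ _⟩

end Modules

/-! ### Equivalence with finite-dimensional contravariant functors -/

section FunctorModules

variable (k : Type t) [Field k]

lemma functor_moduleCat_isColimit {E : Type v₂} [Category.{w₂} E] {X Y Z : E ⥤ ModuleCat.{v} k}
    (f : X ⟶ Y) (g : Y ⟶ Z) (w : f ≫ g = 0) (hg : ∀ e, Function.Surjective (g.app e))
    (hf : ∀ e, ∀ y, g.app e y = 0 → ∃ x, f.app e x = y) :
    Nonempty (IsColimit (CokernelCofork.ofπ g w)) := by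
  refine ⟨evaluationJointlyReflectsColimits _ fun e => ?_⟩
  refine (CokernelCofork.isColimitMapCoconeEquiv _ ((evaluation E (ModuleCat.{v} k)).obj e)).symm ?_
  exact (moduleCat_isColimit (f.app e) (g.app e) (by rw [← NatTrans.comp_app, w]; rfl)
    (hg e) (hf e)).some

variable {A : Type v₁} [Category.{w₁} A] [Preadditive A] [Linear k A] (D : ObjectProperty A)

/-- The restriction to `D` of the functors represented by the objects of `A`. -/
def restrictedYoneda : A ⥤ (D.FullSubcategoryᵒᵖ ⥤ ModuleCat.{w₁} k) :=
  linearYoneda k A ⋙ (Functor.whiskeringLeft _ _ _).obj D.ι.op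

instance : (restrictedYoneda k D).Additive where
  map_add {X Y f g} := by
    ext Z : 2
    apply ModuleCat.hom_ext
    apply LinearMap.ext
    intro u
    exact comp_add _ _ _ _ _ _

instance : (restrictedYoneda k D).Linear k where
  map_smul {X Y} f r := by
    ext Z : 2
    apply ModuleCat.hom_ext
    apply LinearMap.ext
    intro u
    exact Linear.comp_smul _ _ _ _ _ _

lemma finiteOpModules_restrictedYoneda (hfin : ∀ X Y : A, Module.Finite k (X ⟶ Y)) (M : A) :
    finiteOpModules (A := D.FullSubcategory) k ((restrictedYoneda k D).obj M) := by
  refine ⟨⟨fun {X Y f g} => ?_⟩, fun {X Y} r f => ?_, fun X => hfin _ _⟩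
  · apply ModuleCat.hom_ext
    apply LinearMap.ext
    intro u
    exact add_comp _ _ _ _ _ _
  · apply ModuleCat.hom_ext
    apply LinearMap.ext
    intro u
    exact Linear.smul_comp _ _ _ _ _ _

/-- The dual basis argument of `coyonedaObj_bijective`, with naturality along `g ≫ a s` in place of
linearity over an endomorphism ring. -/
lemma restrictedYoneda_bijective {X : A} (hX : FactorsThrough D X) (M : A) :
    Function.Bijective ((restrictedYoneda k D).map :
      (X ⟶ M) → ((restrictedYoneda k D).obj X ⟶ (restrictedYoneda k D).obj M)) := by
  obtain ⟨n, Y, a, b, hY, hab⟩ := hX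
  constructor
  · intro f g h
    rw [← Category.id_comp f, ← Category.id_comp g, ← hab, sum_comp, sum_comp]
    refine Finset.sum_congr rfl fun s _ => ?_
    rw [Category.assoc, Category.assoc]
    exact congrArg (fun z => a s ≫ z) (congrArg (fun z => (z.app (op ⟨Y s, hY s⟩)).hom (b s)) h)
  · intro φ
    let φ' (Z : D.FullSubcategory) : (Z.obj ⟶ X) →ₗ[k] (Z.obj ⟶ M) := (φ.app (op Z)).hom
    have nat : ∀ {Z Z' : D.FullSubcategory} (c : Z ⟶ Z') (u : Z'.obj ⟶ X),
        c.hom ≫ φ' Z' u = φ' Z (c.hom ≫ u) := fun {Z Z'} c u =>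
      (congrArg (fun z => z.hom u) (φ.naturality c.op)).symm
    refine ⟨∑ s, a s ≫ φ' ⟨Y s, hY s⟩ (b s), ?_⟩
    ext Z : 2
    obtain ⟨Z⟩ := Z
    apply ModuleCat.hom_ext
    apply LinearMap.ext
    intro (g : Z.obj ⟶ X)
    have h2 : g ≫ ∑ s, a s ≫ φ' ⟨Y s, hY s⟩ (b s) = φ' Z g := by
      have h1 : ∀ s, g ≫ a s ≫ φ' ⟨Y s, hY s⟩ (b s) = φ' Z (g ≫ a s ≫ b s) := fun s => by
        have := nat (Z := Z) (Z' := ⟨Y s, hY s⟩) (ObjectProperty.homMk (g ≫ a s)) (b s)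
        simpa using this
      rw [comp_sum, Finset.sum_congr rfl (fun s _ => h1 s), ← map_sum, ← comp_sum, hab,
        Category.comp_id]
    exact h2

variable {k} {D}

/-- The linear map assembling elements of a functor `N` at the objects `Y j`. -/
def assemble {N : D.FullSubcategoryᵒᵖ ⥤ ModuleCat.{w₁} k} (hN : finiteOpModules k N)
    {J : Type} [Fintype J] (Y : J → D.FullSubcategory) (x : ∀ j, N.obj (op (Y j)))
    (Z : D.FullSubcategory) : (∀ j, Z ⟶ Y j) →ₗ[k] N.obj (op Z) where
  toFun c := ∑ j, (N.map (c j).op).hom (x j)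
  map_add' c d := by
    have := hN.1
    rw [← Finset.sum_add_distrib]
    refine Finset.sum_congr rfl fun j _ => ?_
    rw [Pi.add_apply, op_add, N.map_add]
    rfl
  map_smul' r c := by
    rw [RingHom.id_apply, Finset.smul_sum]
    refine Finset.sum_congr rfl fun j _ => ?_
    rw [Pi.smul_apply, hN.2.1]
    rfl

lemma assemble_comp {N : D.FullSubcategoryᵒᵖ ⥤ ModuleCat.{w₁} k} (hN : finiteOpModules k N)
    {J : Type} [Fintype J] (Y : J → D.FullSubcategory) (x : ∀ j, N.obj (op (Y j)))
    {Z Z' : D.FullSubcategory} (f : Z ⟶ Z') (c : ∀ j, Z' ⟶ Y j) :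
    assemble hN Y x Z (fun j => f ≫ c j) = (N.map f.op).hom (assemble hN Y x Z' c) := by
  simp only [assemble, LinearMap.coe_mk, AddHom.coe_mk, map_sum]
  refine Finset.sum_congr rfl fun j _ => ?_
  rw [op_comp, N.map_comp]
  rfl

/-- Finite generation of subfunctors of functors with finite-dimensional values on a category with
finitely many isomorphism classes of objects. -/
lemma exists_assemble_surjective
    (hD : ∃ (n : ℕ) (r : Fin n → A), (∀ s, D (r s)) ∧ ∀ X, D X → ∃ s, Nonempty (X ≅ r s))
    {N : D.FullSubcategoryᵒᵖ ⥤ ModuleCat.{w₁} k} (hN : finiteOpModules k N)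
    (S : ∀ Z : D.FullSubcategory, Submodule k (N.obj (op Z)))
    (hS : ∀ {Z Z' : D.FullSubcategory} (f : Z ⟶ Z') (y), y ∈ S Z' → (N.map f.op).hom y ∈ S Z) :
    ∃ (J : Type) (_ : Fintype J) (Y : J → D.FullSubcategory) (x : ∀ j, N.obj (op (Y j))),
      (∀ j, x j ∈ S (Y j)) ∧ ∀ Z, S Z ≤ LinearMap.range (assemble hN Y x Z) := by
  classical
  obtain ⟨n, r, hr, hrep⟩ := hD
  have hfg : ∀ s, (S ⟨r s, hr s⟩).FG := fun s => by
    have := hN.2.2 (op ⟨r s, hr s⟩)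
    exact IsNoetherian.noetherian _
  choose m x hx using fun s => Submodule.fg_iff_exists_fin_generating_family.1 (hfg s)
  refine ⟨Σ s, Fin (m s), inferInstance, fun j => ⟨r j.1, hr j.1⟩, fun j => x j.1 j.2,
    fun j => hx j.1 ▸ Submodule.subset_span (Set.mem_range_self j.2), fun Z y hy => ?_⟩
  obtain ⟨s, ⟨e⟩⟩ := hrep Z.obj Z.property
  let e' : Z ≅ ⟨r s, hr s⟩ := D.isoMk e
  have hmem : (N.map e'.inv.op).hom y ∈ Submodule.span k (Set.range (x s)) := by
    rw [hx s]; exact hS _ _ hy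
  -- It suffices to generate at the representatives: an element at `Z` is carried to `r s`,
  -- expressed there by the generators, and carried back along `e'`.
  have hle : Submodule.span k (Set.range (x s)) ≤
      (LinearMap.range (assemble hN (fun j : Σ s, Fin (m s) => ⟨r j.1, hr j.1⟩)
        (fun j => x j.1 j.2) Z)).comap (N.map e'.hom.op).hom := by
    rw [Submodule.span_le]
    rintro _ ⟨u, rfl⟩
    refine ⟨Pi.single (M := fun j : Σ s, Fin (m s) => (Z ⟶ (⟨r j.1, hr j.1⟩ : D.FullSubcategory)))
      ⟨s, u⟩ e'.hom, ?_⟩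
    have := hN.1
    refine (Finset.sum_eq_single (⟨s, u⟩ : Σ s, Fin (m s)) ?_ ?_).trans ?_
    · intro j _ hj
      rw [Pi.single_eq_of_ne hj, op_zero, N.map_zero]
      rfl
    · intro h; exact absurd (Finset.mem_univ _) h
    · rw [Pi.single_eq_same]
  have := hle hmem
  have h2 : (N.map e'.hom.op).hom ((N.map e'.inv.op).hom y) = y := by
    have : N.map e'.inv.op ≫ N.map e'.hom.op = 𝟙 _ := by
      rw [← N.map_comp, ← op_comp, e'.hom_inv_id, op_id, N.map_id]
    exact congrArg (fun z => z.hom y) this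
  rwa [Submodule.mem_comap, h2] at this

/-- Objects presented by finite sums of objects of `D`, on which `Hom(G, -)` is exact for `G` in
`D`, form a category equivalent to the category of finite-dimensional functors on `D`. -/
lemma exists_equivalence_opMod [HasCokernels A] [HasFiniteBiproducts A] (Q : ObjectProperty A)
    (hfin : ∀ X Y : A, Module.Finite k (X ⟶ Y))
    (hD : ∃ (n : ℕ) (r : Fin n → A), (∀ s, D (r s)) ∧ ∀ X, D X → ∃ s, Nonempty (X ≅ r s))
    (hQ : ∀ X, Q X → FactorsThrough D X)
    (hQ' : ∀ X, IsFiniteSum D X → Q X)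
    (hex : ∀ G, D G → ∀ ⦃X₁ X₀ M : A⦄ (a : X₁ ⟶ X₀) (p : X₀ ⟶ M) (w : a ≫ p = 0), Q X₁ → Q X₀ →
      Nonempty (IsColimit (CokernelCofork.ofπ p w)) → ExactOn G a p) :
    ∃ e : (presentedBy Q).FullSubcategory ≌ OpMod k D.FullSubcategory, e.functor.Linear k := by
  have hpres : PreservesPresentations (restrictedYoneda k D) Q := by
    intro X₁ X₀ M a p w h₁ h₀ hp
    exact functor_moduleCat_isColimit k _ _ _
      (fun Z => (hex _ Z.unop.property a p w h₁ h₀ hp).1)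
      (fun Z => (hex _ Z.unop.property a p w h₁ h₀ hp).2)
  have hB := fun (X M : A) (hX : Q X) (_ : presentedBy Q M) =>
    restrictedYoneda_bijective k D (hQ X hX) M
  obtain ⟨e, he⟩ := exists_presentedBy_equivalence (restrictedYoneda k D) Q hB hpres
    (finiteOpModules k) (fun M _ => finiteOpModules_restrictedYoneda k D hfin M) (by
      intro N hN
      -- Finitely many elements generate all of `N`; by the Yoneda principle they define the
      -- epimorphism `ψ` from the functor of the sum `P`.
      obtain ⟨J, _, Y, x, -, hx⟩ := exists_assemble_surjective hD hN (fun _ => ⊤)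
        (fun _ _ _ => trivial)
      let P : A := ⨁ fun j => (Y j).obj
      let comp (Z : D.FullSubcategory) : (Z.obj ⟶ P) →ₗ[k] (∀ j, Z ⟶ Y j) :=
        { toFun := fun u j => ObjectProperty.homMk (u ≫ biproduct.π _ j)
          map_add' := fun u v => by
            funext j; exact ObjectProperty.hom_ext _ (add_comp _ _ _ _ _ _)
          map_smul' := fun r u => by
            funext j; exact ObjectProperty.hom_ext _ (Linear.smul_comp _ _ _ _ _ _) }
      let ψ : (restrictedYoneda k D).obj P ⟶ N :=
        { app := fun Z => ModuleCat.ofHom ((assemble hN Y x Z.unop).comp (comp Z.unop))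
          naturality := fun Z Z' f => by
            apply ModuleCat.hom_ext
            apply LinearMap.ext
            intro (u : Z.unop.obj ⟶ P)
            refine Eq.trans ?_ (assemble_comp hN Y x f.unop (comp Z.unop u))
            refine congrArg (assemble hN Y x Z'.unop) ?_
            funext j
            exact ObjectProperty.hom_ext _ (Category.assoc _ _ _) }
      have hψ : ∀ Z, Function.Surjective (ψ.app Z) := fun Z y => by
        obtain ⟨c, hc⟩ := hx Z.unop (x := y) trivial
        refine ⟨biproduct.lift fun j => (c j).hom, Eq.trans ?_ hc⟩
        refine congrArg (assemble hN Y x Z.unop) ?_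
        funext j
        exact ObjectProperty.hom_ext _ (biproduct.lift_π _ _)
      -- The kernel of `ψ` is again generated by finitely many elements, now morphisms into `P`,
      -- which assemble to the relation map `d`.
      obtain ⟨J', _, Y', z, hz0, hz⟩ := exists_assemble_surjective hD
        (finiteOpModules_restrictedYoneda k D hfin P) (fun Z => LinearMap.ker (ψ.app (op Z)).hom)
        (fun {Z Z'} f y hy => by
          rw [LinearMap.mem_ker] at hy ⊢
          have := congrArg (fun q => q.hom y) (ψ.naturality f.op)
          refine this.trans ?_
          exact (congrArg (N.map f.op).hom hy).trans (map_zero _))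
      let z' : ∀ j, (Y' j).obj ⟶ P := z
      let d : (⨁ fun j => (Y' j).obj) ⟶ P := biproduct.desc z'
      have hd : (restrictedYoneda k D).map d ≫ ψ = 0 := by
        have : d ≫ 𝟙 P = ∑ j, biproduct.π _ j ≫ z' j := by
          rw [Category.comp_id, ← Category.id_comp d, ← biproduct.total, sum_comp]
          simp [d]
        rw [Category.comp_id] at this
        rw [this, Functor.map_sum, sum_comp]
        refine Finset.sum_eq_zero fun j _ => ?_
        ext Z : 2
        apply ModuleCat.hom_ext
        apply LinearMap.ext
        intro (u : Z.unop.obj ⟶ _)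
        have h1 := congrArg (fun q => q.hom (z j)) (ψ.naturality
          (ObjectProperty.homMk (u ≫ biproduct.π _ j) : Z.unop ⟶ Y' j).op)
        refine Eq.trans ?_ (h1.trans ((congrArg (N.map _).hom (LinearMap.mem_ker.1 (hz0 j))).trans
          (map_zero _)))
        exact congrArg (ψ.app Z).hom (Category.assoc _ _ _).symm
      have hfs : ∀ {J : Type} [Fintype J] (Y : J → D.FullSubcategory), Q (⨁ fun j => (Y j).obj) :=
        fun Y => hQ' _ (IsFiniteSum.of_fintype _ (fun j => (Y j).property) (Iso.refl _))
      refine exists_presentedBy_iso (restrictedYoneda k D) Q hB hpres (hfs Y') (hfs Y)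
        ((restrictedYoneda k D).map d) ψ hd (functor_moduleCat_isColimit k _ _ hd hψ ?_).some
      intro Z y hy
      obtain ⟨c, hc⟩ := hz Z.unop (LinearMap.mem_ker.2 hy)
      refine ⟨biproduct.lift fun j => (c j).hom, Eq.trans ?_ hc⟩
      change biproduct.lift (fun j => (c j).hom) ≫ biproduct.desc z' = ∑ j, (c j).hom ≫ z' j
      rw [biproduct.lift_desc])
  exact ⟨e, he ▸ lift_linear _ k _ _ _⟩

end FunctorModules

/-! ### Projectives and abelianness of the category of arrows modulo homotopy -/

section Freyd

variable {V : Type v₁} [Category.{w₁} V] [Preadditive V] [HasFiniteBiproducts V]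

/-- The candidate cokernel `N ⟶ (N.left ⊞ M.right ⟶ N.right)` is killed by `e`, hence is zero when
`e` is epi. A null-homotopy of it, whose right component is the identity, has `s` and `t` as its two
components. -/
lemma freyd_exists_section {V : Type v₁} [Category.{w₁} V] [Preadditive V] [HasBinaryBiproducts V]
    {M N : Arrow V} (e : M ⟶ N)
    [Epi ((RightFreyd.quotient V).map e)] :
    ∃ (s : N.right ⟶ N.left) (t : N.right ⟶ M.right), s ≫ N.hom + t ≫ e.right = 𝟙 N.right := by
  have h0 : (RightFreyd.quotient V).map (RightFreyd.Candidate.π e) = 0 := by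
    rw [← cancel_epi ((RightFreyd.quotient V).map e), comp_zero, ← Functor.map_comp,
      RightFreyd.quotient_map_eq_zero_iff]
    exact ⟨RightFreyd.Candidate.condition e⟩
  obtain ⟨h⟩ := (RightFreyd.quotient_map_eq_zero_iff _).1 h0
  refine ⟨h.hom ≫ biprod.fst, h.hom ≫ biprod.snd, ?_⟩
  have := h.comm
  have h2 : (RightFreyd.Candidate.π e).right = 𝟙 N.right := rfl
  rw [h2] at this
  simp only [Arrow.mk_hom, biprod.desc_eq, comp_add] at this
  rw [Category.assoc, Category.assoc, ← this]
  exact sub_zero _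

instance freyd_projective (X : V) : Projective ((RightFreyd.functor V).obj X) where
  factors {E B} f e he := by
    have : HasBinaryBiproducts V := hasBinaryBiproducts_of_finite_biproducts _
    obtain ⟨M, rfl⟩ : ∃ M, (RightFreyd.quotient V).obj M = E := ⟨E.as, rfl⟩
    obtain ⟨N, rfl⟩ : ∃ M, (RightFreyd.quotient V).obj M = B := ⟨B.as, rfl⟩
    obtain ⟨f, rfl⟩ := (RightFreyd.quotient V).map_surjective f
    obtain ⟨e, rfl⟩ := (RightFreyd.quotient V).map_surjective e
    obtain ⟨s, t, hst⟩ := freyd_exists_section e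
    -- The lift comes from `t`; the error term `f.right ≫ s ≫ N.hom` factors through `N.hom` and is
    -- therefore homotopic to zero.
    refine ⟨(RightFreyd.quotient V).map (Arrow.homMk 0 (f.right ≫ t)
      ((isZero_zero V).eq_of_src _ _)), ?_⟩
    rw [← Functor.map_comp]
    refine RightFreyd.eq_of_rightHomotopy _ _ ⟨-f.right ≫ s, ?_⟩
    let g : X ⟶ N.right := f.right
    have h3 : g = g ≫ s ≫ N.hom + g ≫ t ≫ e.right := by
      rw [← comp_add, hst, Category.comp_id]
    have h4 : (g ≫ t) ≫ e.right - g = (-g ≫ s) ≫ N.hom := by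
      rw [sub_eq_iff_eq_add]
      conv_rhs => rhs; rw [h3]
      simp
    exact h4

/-- The canonical epimorphism `P_Y ⟶ (X ⟶ Y)`. -/
def freydCover (M : Arrow V) :
    (RightFreyd.functor V).obj M.right ⟶ (RightFreyd.quotient V).obj M :=
  (RightFreyd.quotient V).map (Arrow.homMk 0 (𝟙 M.right) ((isZero_zero V).eq_of_src _ _))

instance (M : Arrow V) : Epi (freydCover M) := by
  have : IsIso (Arrow.homMk (f := (RightFreyd.rightFunctor V).obj M.right) (g := M) 0 (𝟙 M.right)
      ((isZero_zero V).eq_of_src _ _)).right := inferInstanceAs (IsIso (𝟙 M.right))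
  exact RightFreyd.epi_of_isIso_right _

lemma freydCover_condition (M : Arrow V) :
    (RightFreyd.functor V).map M.hom ≫ freydCover M = 0 := by
  refine (Functor.map_comp _ _ _).symm.trans ((RightFreyd.quotient_map_eq_zero_iff _).2 ⟨⟨𝟙 _, ?_⟩⟩)
  refine (sub_zero _).trans ?_
  change M.hom ≫ 𝟙 _ = 𝟙 _ ≫ M.hom
  simp

lemma freyd_cover_exact {M : Arrow V} {Z : V} (g : (RightFreyd.functor V).obj Z ⟶
    (RightFreyd.functor V).obj M.right) (h : g ≫ freydCover M = 0) :
    ∃ c, c ≫ (RightFreyd.functor V).map M.hom = g := by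
  obtain ⟨g, rfl⟩ := (RightFreyd.functor V).map_surjective g
  obtain ⟨c⟩ := (RightFreyd.quotient_map_eq_zero_iff _).1 ((Functor.map_comp _ _ _).trans h)
  refine ⟨(RightFreyd.functor V).map c.hom, ?_⟩
  have h2 : c.hom ≫ M.hom = g := c.comm.symm.trans ((sub_zero _).trans (Category.comp_id g))
  exact (Functor.map_comp _ _ _).symm.trans (congrArg _ h2)

/-- A null-homotopy of `M.hom ≫ g.right` is exactly the missing left component of a commutative
square from `M`. So every object is canonically the cokernel of a map between projectives. -/
lemma freydCover_isColimit (M : Arrow V) :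
    Nonempty (IsColimit (CokernelCofork.ofπ (freydCover M) (freydCover_condition M))) := by
  refine ⟨CokernelCofork.IsColimit.ofπ' _ _ fun {N} g hg => Nonempty.some ?_⟩
  obtain ⟨N, rfl⟩ : ∃ M, (RightFreyd.quotient V).obj M = N := ⟨N.as, rfl⟩
  obtain ⟨g, rfl⟩ := (RightFreyd.quotient V).map_surjective g
  obtain ⟨c⟩ := (RightFreyd.quotient_map_eq_zero_iff _).1 ((Functor.map_comp _ _ _).trans hg)
  have hc : M.hom ≫ g.right = c.hom ≫ N.hom := by
    have := c.comm
    exact (sub_zero _).symm.trans this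
  refine ⟨(RightFreyd.quotient V).map (Arrow.homMk c.hom g.right hc.symm), ?_⟩
  refine (Functor.map_comp _ _ _).symm.trans (congrArg _ ?_)
  ext
  · exact (isZero_zero V).eq_of_src _ _
  · exact Category.id_comp _

/-- The objects isomorphic to some `P_X`. -/
def freydProjectives : ObjectProperty (RightFreyd V) :=
  fun M => ∃ X, Nonempty (M ≅ (RightFreyd.functor V).obj X)

lemma presentedBy_freydProjectives (M : RightFreyd V) : presentedBy freydProjectives M :=
  ⟨_, _, _, freydCover M.as, freydCover_condition M.as, ⟨_, ⟨Iso.refl _⟩⟩, ⟨_, ⟨Iso.refl _⟩⟩,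
    freydCover_isColimit M.as⟩

/-- Surjectivity is projectivity. Middle exactness, needed before abelianness is known, is read off
from null-homotopies: the presentation comes from an arrow `b` of `V`, and `freyd_cover_exact`
applies to its canonical cover. -/
lemma freyd_exactOn (G : V) {X₁ X₀ M : RightFreyd V} (a : X₁ ⟶ X₀) (p : X₀ ⟶ M) (w : a ≫ p = 0)
    (h₁ : freydProjectives X₁) (h₀ : freydProjectives X₀)
    (hp : Nonempty (IsColimit (CokernelCofork.ofπ p w))) :
    ExactOn ((RightFreyd.functor V).obj G) a p := by
  obtain ⟨hp⟩ := hp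
  have ep : Epi p := ⟨fun f g h => Cofork.IsColimit.hom_ext hp h⟩
  refine ⟨fun f => ⟨Projective.factorThru f p, Projective.factorThru_comp f p⟩, fun g hg => ?_⟩
  obtain ⟨Y₁, ⟨e₁⟩⟩ := h₁
  obtain ⟨Y₀, ⟨e₀⟩⟩ := h₀
  obtain ⟨b, hb⟩ := (RightFreyd.functor V).map_surjective (e₁.inv ≫ a ≫ e₀.hom)
  have hw : a ≫ e₀.hom ≫ freydCover (Arrow.mk b) = 0 := by
    have := freydCover_condition (Arrow.mk b)
    rw [← cancel_epi e₁.inv, comp_zero, ← this]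
    simp only [Arrow.mk_hom]
    erw [hb]
    simp
  have hq : p ≫ hp.desc (CokernelCofork.ofπ _ hw) = e₀.hom ≫ freydCover (Arrow.mk b) :=
    hp.fac (CokernelCofork.ofπ _ hw) WalkingParallelPair.one
  obtain ⟨c, hc⟩ := freyd_cover_exact (M := Arrow.mk b) (g ≫ e₀.hom) (by
    rw [Category.assoc, ← hq, reassoc_of% hg, zero_comp])
  refine ⟨c ≫ e₁.inv, ?_⟩
  rw [← cancel_mono e₀.hom, ← hc]
  change _ = c ≫ (RightFreyd.functor V).map b
  rw [hb]; simp

variable (k : Type t) [Field k] [Linear k V]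

lemma freyd_finite_hom {V : Type v₁} [Category.{w₁} V] [Preadditive V] [Linear k V]
    (hfin : ∀ X Y : V, Module.Finite k (X ⟶ Y)) (M N : RightFreyd V) :
    Module.Finite k (M ⟶ N) := by
  have := hfin
  let q : (M.as ⟶ N.as) →ₗ[k] (M ⟶ N) := (RightFreyd.quotient V).mapLinearMap k
  let j : (M.as ⟶ N.as) →ₗ[k] ((M.as.left ⟶ N.as.left) × (M.as.right ⟶ N.as.right)) :=
    { toFun := fun f => (f.left, f.right)
      map_add' := fun _ _ => rfl
      map_smul' := fun _ _ => rfl }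
  have : Module.Finite k (M.as ⟶ N.as) := Module.Finite.of_injective j fun f g h => by
    ext
    · exact congrArg Prod.fst h
    · exact congrArg Prod.snd h
  exact Module.Finite.of_surjective q (RightFreyd.quotient V).map_surjective

variable (V) in
/-- The abelianization `RightFreyd V` is an abelian category. -/
class IsFreydAbelian : Prop where
  hasKernels : HasKernels (RightFreyd V)
  normalMono : IsNormalMonoCategory (RightFreyd V)
  normalEpi : IsNormalEpiCategory (RightFreyd V)

/-- Built on the existing preadditive structure, so zero morphisms and sums remain the given ones.
-/
instance freydAbelian [IsFreydAbelian V] : Abelian (RightFreyd V) :=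
  have : HasBinaryBiproducts V := hasBinaryBiproducts_of_finite_biproducts _
  { (inferInstance : Preadditive (RightFreyd V)), (IsFreydAbelian.normalMono (V := V)),
    (IsFreydAbelian.normalEpi (V := V)) with
    has_finite_products := inferInstance
    has_kernels := IsFreydAbelian.hasKernels
    has_cokernels := inferInstance }

/-- Every object is presented by projectives `P_X`, each a summand-type factor of powers of `P_G`.
Hence the category is equivalent to finitely generated modules over a noetherian ring, and
abelianness is transported back. -/
lemma isFreydAbelian (hfin : ∀ X Y : V, Module.Finite k (X ⟶ Y)) (G : V)
    (hG : ∀ X : V, FactorsThrough (fun Y => Y = G) X) : IsFreydAbelian V := by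
  have : HasBinaryBiproducts V := hasBinaryBiproducts_of_finite_biproducts _
  obtain ⟨e, -⟩ := exists_equivalence_fgModuleCat ((RightFreyd.functor V).obj G)
    (freydProjectives (V := V)) k (freyd_finite_hom k hfin)
    (by
      rintro M ⟨X, ⟨e⟩⟩
      exact (hG X).map (RightFreyd.functor V) e (fun Y h => by rw [h]))
    (fun n => ⟨⨁ fun _ : Fin n => G, ⟨((RightFreyd.functor V).mapBiproduct _).symm⟩⟩)
    (fun X₁ X₀ M a p w h₁ h₀ hp => freyd_exactOn G a p w h₁ h₀ hp)
  have := finite_end_op ((RightFreyd.functor V).obj G) k (freyd_finite_hom k hfin)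
  have : IsNoetherianRing (End ((RightFreyd.functor V).obj G))ᵐᵒᵖ :=
    isNoetherian_of_tower k inferInstance
  let F : RightFreyd V ⥤ (presentedBy (freydProjectives (V := V))).FullSubcategory :=
    ObjectProperty.lift _ (𝟭 _) presentedBy_freydProjectives
  have : F.IsEquivalence :=
    { faithful := ⟨fun h => congrArg (fun z => z.hom) h⟩
      full := ⟨fun f => ⟨f.hom, rfl⟩⟩
      essSurj := ⟨fun X => ⟨X.obj, ⟨Iso.refl _⟩⟩⟩ }
  let ab : Abelian (RightFreyd V) := abelianOfEquivalence (F ⋙ e.functor)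
  exact ⟨ab.has_kernels, ab.toIsNormalMonoCategory, ab.toIsNormalEpiCategory⟩

end Freyd

/-! ### Simple tops and composition multiplicities in hom-finite abelian categories -/

section SimpleTop

variable {A : Type v₁} [Category.{w₁} A] [Abelian A]

lemma shortExact_cokernel {X Y : A} (f : X ⟶ Y) [Mono f] :
    (ShortComplex.mk f (cokernel.π f) (cokernel.condition f)).ShortExact where
  exact := ShortComplex.exact_of_g_is_cokernel _ (cokernelIsCokernel f)
  mono_f := ‹_›
  epi_g := inferInstance

lemma shortExact_kernel {X Y : A} (f : X ⟶ Y) [Epi f] :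
    (ShortComplex.mk (kernel.ι f) f (kernel.condition f)).ShortExact where
  exact := ShortComplex.exact_of_f_is_kernel _ (kernelIsKernel f)
  mono_f := inferInstance
  epi_g := ‹_›

lemma not_isZero_of_simple {S : A} (hS : Simple S) : ¬ IsZero S := Simple.not_isZero S

lemma ne_zero_of_epi_simple {M S : A} (hS : Simple S) (p : M ⟶ S) [Epi p] : p ≠ 0 := fun h =>
  not_isZero_of_simple hS (IsZero.of_epi_eq_zero p h)

lemma exists_factor_of_kernel_comp_eq_zero {X Y Z : A} (p : X ⟶ Y) [Epi p] (q : X ⟶ Z)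
    (h : kernel.ι p ≫ q = 0) : ∃ u : Y ⟶ Z, p ≫ u = q :=
  ⟨(Abelian.epiIsCokernelOfKernel _ (kernelIsKernel p)).desc (CokernelCofork.ofπ q h),
    (Abelian.epiIsCokernelOfKernel _ (kernelIsKernel p)).fac (CokernelCofork.ofπ q h)
      WalkingParallelPair.one⟩

lemma HasSimpleTop.not_isZero {M S : A} (h : HasSimpleTop M S) : ¬ IsZero M := by
  obtain ⟨hS, p, hp, -⟩ := h
  intro hM
  exact not_isZero_of_simple hS (IsZero.of_epi p hM)

lemma HasSimpleTop.of_iso {M N S : A} (h : HasSimpleTop M S) (e : M ≅ N) : HasSimpleTop N S := by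
  obtain ⟨hS, p, hp, H⟩ := h
  refine ⟨hS, e.inv ≫ p, epi_comp _ _, fun T q hT hq => ?_⟩
  obtain ⟨u, hu⟩ := H T (e.hom ≫ q) hT (fun h0 => hq ((cancel_epi e.hom).1 (by simpa using h0)))
  exact ⟨u, by rw [Category.assoc, ← hu, e.inv_hom_id_assoc]⟩

/-- Any nonzero morphism to a simple object can serve as the projection to the simple top. -/
lemma HasSimpleTop.factor {M S : A} (h : HasSimpleTop M S) {T T' : A} (q : M ⟶ T) (hT : Simple T)
    (hq : q ≠ 0) (q' : M ⟶ T') (hT' : Simple T') (hq' : q' ≠ 0) : ∃ e : T ≅ T', q' = q ≫ e.hom := by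
  obtain ⟨hS, p, hp, H⟩ := h
  obtain ⟨e, he⟩ := H T q hT hq
  obtain ⟨e', he'⟩ := H T' q' hT' hq'
  exact ⟨e.symm ≪≫ e', by simp [he, he']⟩

lemma HasSimpleTop.of_ne_zero {M S : A} (h : HasSimpleTop M S) {T : A} (q : M ⟶ T) (hT : Simple T)
    (hq : q ≠ 0) : HasSimpleTop M T :=
  ⟨hT, q, epi_of_nonzero_to_simple hq, fun _ q' hT' hq' => h.factor q hT hq q' hT' hq'⟩

lemma hasSimpleTop_of_forall_factor {M S : A} (hS : Simple S) (p : M ⟶ S) [Epi p]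
    (h : ∀ (T : A) (q : M ⟶ T), Simple T → q ≠ 0 → kernel.ι p ≫ q = 0) : HasSimpleTop M S := by
  refine ⟨hS, p, inferInstance, fun T q hT hq => ?_⟩
  obtain ⟨u, hu⟩ := exists_factor_of_kernel_comp_eq_zero p q (h T q hT hq)
  have hu0 : u ≠ 0 := by rintro rfl; exact hq (by rw [← hu, comp_zero])
  have := isIso_of_hom_simple hu0
  exact ⟨asIso u, hu.symm⟩

variable (k : Type t) [Field k] [Linear k A]

variable (A) in
/-- A hom-finite category with a projective generator. -/
structure IsHomFiniteWithGenerator : Prop where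
  finite_hom : ∀ X Y : A, Module.Finite k (X ⟶ Y)
  exists_generator : ∃ G : A, Projective G ∧ ∀ M : A, ¬ IsZero M → ∃ f : G ⟶ M, f ≠ 0

variable {k}

lemma finrank_hom_of_shortExact (hfin : ∀ X Y : A, Module.Finite k (X ⟶ Y)) (P : A) [Projective P]
    {S : ShortComplex A} (hS : S.ShortExact) :
    Module.finrank k (P ⟶ S.X₂) = Module.finrank k (P ⟶ S.X₁) + Module.finrank k (P ⟶ S.X₃) := by
  have := hfin
  have := hS.mono_f
  have := hS.epi_g
  let φ : (P ⟶ S.X₂) →ₗ[k] (P ⟶ S.X₃) := Linear.rightComp k P S.g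
  let ψ : (P ⟶ S.X₁) →ₗ[k] (P ⟶ S.X₂) := Linear.rightComp k P S.f
  have hφ : LinearMap.range φ = ⊤ := LinearMap.range_eq_top.2 fun f =>
    ⟨Projective.factorThru f S.g, Projective.factorThru_comp f S.g⟩
  have hψ : Function.Injective ψ := fun f g h => (cancel_mono S.f).1 h
  have hker : LinearMap.ker φ = LinearMap.range ψ := by
    ext f
    constructor
    · intro hf
      exact ⟨hS.exact.lift f hf, hS.exact.lift_f f hf⟩
    · rintro ⟨g, rfl⟩
      change (g ≫ S.f) ≫ S.g = 0
      simp
  have h := LinearMap.finrank_range_add_finrank_ker φ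
  rw [hφ, finrank_top, hker, LinearMap.finrank_range_of_inj hψ] at h
  omega

/-- Induction on the length of objects: an object is built from a simple quotient and its kernel. -/
lemma IsHomFiniteWithGenerator.exists_length (hA : IsHomFiniteWithGenerator A k) :
    ∃ d : A → ℕ, (∀ M, d M = 0 → IsZero M) ∧
      ∀ S : ShortComplex A, S.ShortExact → d S.X₂ = d S.X₁ + d S.X₃ := by
  obtain ⟨G, hG, hgen⟩ := hA.exists_generator
  refine ⟨fun M => Module.finrank k (G ⟶ M), fun M hM => ?_,
    fun S hS => finrank_hom_of_shortExact hA.finite_hom G hS⟩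
  by_contra hz
  obtain ⟨f, hf⟩ := hgen M hz
  have := hA.finite_hom G M
  have := Module.finrank_zero_iff.1 hM
  exact hf (Subsingleton.elim _ _)

/-- If `M` is not simple, quotient by a proper nonzero subobject; the length function strictly
decreases. -/
lemma IsHomFiniteWithGenerator.exists_simple_quotient (hA : IsHomFiniteWithGenerator A k)
    {M : A} (hM : ¬ IsZero M) : ∃ (S : A) (p : M ⟶ S), Simple S ∧ Epi p := by
  obtain ⟨d, hd0, hd⟩ := hA.exists_length
  induction hn : d M using Nat.strong_induction_on generalizing M with
  | _ n ih =>
    by_cases hs : Simple M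
    · exact ⟨M, 𝟙 M, hs, inferInstance⟩
    have : ∃ (Y : A) (f : Y ⟶ M), Mono f ∧ f ≠ 0 ∧ ¬ IsIso f := by
      by_contra! hcon
      refine hs ⟨fun {Y} f hf => ⟨fun hi h0 => ?_, fun h0 => hcon Y f hf h0⟩⟩
      subst h0
      exact hM (IsZero.of_epi (0 : Y ⟶ M) (IsZero.of_mono_eq_zero (0 : Y ⟶ M) rfl))
    obtain ⟨Y, f, hf, h0, hi⟩ := this
    have hY : 0 < d Y := Nat.pos_of_ne_zero fun h => h0 ((hd0 _ h).eq_of_src _ _)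
    have hc : ¬ IsZero (cokernel f) := fun hz => hi (by
      have : Epi f := Preadditive.epi_of_isZero_cokernel f hz
      exact isIso_of_mono_of_epi f)
    have h1 : d M = d Y + d (cokernel f) := hd _ (shortExact_cokernel f)
    obtain ⟨S, p, hS, hp⟩ := ih _ (by omega) hc rfl
    exact ⟨S, cokernel.π f ≫ p, hS, epi_comp _ _⟩

/-- Dévissage along simple quotients. -/
lemma IsHomFiniteWithGenerator.induction (hA : IsHomFiniteWithGenerator A k) {P : A → Prop}
    (zero : ∀ M, IsZero M → P M)
    (step : ∀ {M T : A} (p : M ⟶ T), Simple T → Epi p → P (kernel p) → P M) (M : A) : P M := by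
  obtain ⟨d, hd0, hd⟩ := hA.exists_length
  induction hn : d M using Nat.strong_induction_on generalizing M with
  | _ n ih =>
    by_cases hM : IsZero M
    · exact zero M hM
    obtain ⟨S, p, hS, hp⟩ := hA.exists_simple_quotient hM
    have h1 : d M = d (kernel p) + d S := hd _ (shortExact_kernel p)
    have h2 : 0 < d S := Nat.pos_of_ne_zero fun h => not_isZero_of_simple hS (hd0 _ h)
    exact step p hS hp (ih _ (by omega) _ rfl)

lemma IsHomFiniteWithGenerator.exists_compMult (hA : IsHomFiniteWithGenerator A k) (S M : A) :
    ∃ m, CompMult S M m := by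
  refine hA.induction (P := fun M => ∃ m, CompMult S M m) (fun M hM => ⟨0, .zero hM⟩) ?_ M
  rintro M T p hT hp ⟨m, hm⟩
  by_cases e : Nonempty (T ≅ S)
  · exact ⟨m + 1, .iso _ (shortExact_kernel p) hT e hm⟩
  · exact ⟨m, .notIso _ (shortExact_kernel p) hT (not_nonempty_iff.1 e) hm⟩

/-- A form of Nakayama's lemma: were `cokernel φ` nonzero, it would have a simple quotient. All
nonzero maps from `M` to simples agree up to isomorphism of the target, so `q` would vanish on the
image of `φ`. -/
lemma HasSimpleTop.epi_of_comp_ne_zero (hA : IsHomFiniteWithGenerator A k) {M S : A}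
    (h : HasSimpleTop M S) {N T : A} (φ : N ⟶ M) (q : M ⟶ T) (hT : Simple T) (hq : φ ≫ q ≠ 0) :
    Epi φ := by
  by_contra hφ
  have hc : ¬ IsZero (cokernel φ) := fun hz => hφ (Preadditive.epi_of_isZero_cokernel φ hz)
  obtain ⟨T', r, hT', hr⟩ := hA.exists_simple_quotient hc
  have hr0 : cokernel.π φ ≫ r ≠ 0 := fun h0 =>
    not_isZero_of_simple hT' (IsZero.of_epi_eq_zero _ h0)
  obtain ⟨e, he⟩ := h.factor _ hT' hr0 q hT (by rintro rfl; simp at hq)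
  rw [he] at hq
  simp at hq

/-- A projective object with local endomorphism ring has a simple top. -/
lemma IsHomFiniteWithGenerator.exists_hasSimpleTop (hA : IsHomFiniteWithGenerator A k) {P : A}
    [Projective P] (hP : ¬ IsZero P) (hloc : ∀ a : P ⟶ P, IsIso a ∨ IsIso (𝟙 P - a)) :
    ∃ S, HasSimpleTop P S := by
  obtain ⟨S, p, hS, hp⟩ := hA.exists_simple_quotient hP
  have hp0 : p ≠ 0 := ne_zero_of_epi_simple hS p
  refine ⟨S, hasSimpleTop_of_forall_factor hS p fun T q hT hq => ?_⟩
  by_contra hne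
  have := epi_of_nonzero_to_simple hne
  -- The endomorphism `c ≫ kernel.ι p` is killed by `p` and fixes `q`. If it is invertible then `p =
  -- 0`, and if its complement is invertible then `q = 0`.
  let c := Projective.factorThru q (kernel.ι p ≫ q)
  have hc : c ≫ kernel.ι p ≫ q = q := Projective.factorThru_comp _ _
  rcases hloc (c ≫ kernel.ι p) with h | h
  · apply hp0
    rw [← cancel_epi (c ≫ kernel.ι p)]
    simp
  · apply hq
    rw [← cancel_epi (𝟙 P - c ≫ kernel.ι p)]
    simp [sub_comp, hc]

/-- `Hom(P, -)` is exact, has the dimension of `End S` on simples isomorphic to `S`, and vanishes on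
all other simples. -/
lemma finrank_hom_eq_mul (hfin : ∀ X Y : A, Module.Finite k (X ⟶ Y)) {P S : A} [Projective P]
    (hP : HasSimpleTop P S) {M : A} {m : ℕ} (hM : CompMult S M m) :
    Module.finrank k (P ⟶ M) = m * Module.finrank k (S ⟶ S) := by
  have := hfin
  obtain ⟨hS, p, hp, H⟩ := hP
  induction hM with
  | zero hM =>
    have : Subsingleton (P ⟶ _) := ⟨fun f g => hM.eq_of_tgt f g⟩
    rw [Module.finrank_zero_of_subsingleton, zero_mul]
  | @iso N M T m p' w h hT e n hN ih =>
    have h1 := finrank_hom_of_shortExact hfin P h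
    have h2 : Module.finrank k (P ⟶ T) = Module.finrank k (S ⟶ S) := by
      obtain ⟨e⟩ := e
      let φ : (S ⟶ S) →ₗ[k] (P ⟶ T) := (Linear.leftComp k T p).comp (Linear.rightComp k S e.inv)
      refine (LinearEquiv.finrank_eq
        (LinearEquiv.ofBijective φ ⟨fun f g hfg => ?_, fun q => ?_⟩)).symm
      · have : p ≫ f ≫ e.inv = p ≫ g ≫ e.inv := hfg
        rwa [cancel_epi, cancel_mono] at this
      · by_cases hq : q = 0
        · exact ⟨0, by rw [hq, map_zero]⟩
        · obtain ⟨u, hu⟩ := H T q hT hq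
          refine ⟨u.hom ≫ e.hom, ?_⟩
          change p ≫ (u.hom ≫ e.hom) ≫ e.inv = q
          simp [hu]
    change Module.finrank k (P ⟶ M) = _ + Module.finrank k (P ⟶ T) at h1
    rw [h1, h2, ih, add_mul, one_mul]
  | @notIso N M T m p' w h hT e n hN ih =>
    have h1 := finrank_hom_of_shortExact hfin P h
    have h2 : Module.finrank k (P ⟶ T) = 0 := by
      have : Subsingleton (P ⟶ T) := subsingleton_of_forall_eq 0 fun q => by
        by_contra hq
        obtain ⟨u, -⟩ := H T q hT hq
        exact e.false u.symm
      exact Module.finrank_zero_of_subsingleton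
    change Module.finrank k (P ⟶ M) = _ + Module.finrank k (P ⟶ T) at h1
    rw [h1, h2, ih, add_zero]

end SimpleTop

/-! ### Exact functors and minimal subobjects with annihilated quotient -/

section ExactFunctors

variable {A : Type v₁} [Category.{w₁} A] [Abelian A] {B : Type v₂} [Category.{w₂} B] [Abelian B]
  (F : A ⥤ B) [PreservesFiniteLimits F] [PreservesFiniteColimits F]

omit [PreservesFiniteLimits F] in
lemma epi_map_iff_isZero [F.Additive] {X Y : A} (f : X ⟶ Y) :
    Epi (F.map f) ↔ IsZero (F.obj (cokernel f)) := by
  have e : F.obj (cokernel f) ≅ cokernel (F.map f) := PreservesCokernel.iso F f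
  constructor
  · intro h
    exact (isZero_cokernel_of_epi (F.map f)).of_iso e
  · intro h
    exact Preadditive.epi_of_isZero_cokernel _ (h.of_iso e.symm)

variable {k : Type t} [Field k] [Linear k A]

lemma isZero_map_of_forall_subquotient [F.Additive] (hA : IsHomFiniteWithGenerator A k) (M : A)
    (h : ∀ S, Simple S → IsSubquotient S M → IsZero (F.obj S)) : IsZero (F.obj M) := by
  revert h
  refine hA.induction (P := fun M => (∀ S, Simple S → IsSubquotient S M → IsZero (F.obj S)) →
    IsZero (F.obj M)) (fun M hM _ => F.map_isZero hM) ?_ M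
  intro M T p hT hp ih h
  have hK : IsZero (F.obj (kernel p)) := ih fun S hS ⟨N, m, q, hm, hq⟩ =>
    h S hS ⟨N, m ≫ kernel.ι p, q, mono_comp _ _, hq⟩
  have hFT : IsZero (F.obj T) := h T hT ⟨M, 𝟙 M, p, inferInstance, hp⟩
  have hs := (shortExact_kernel p).map_of_exact F
  exact hs.exact.isZero_of_both_zeros (hK.eq_of_src _ _) (hFT.eq_of_tgt _ _)

/-- The smallest subobject of `P` with `F`-trivial quotient: none of its simple quotients is
annihilated by `F`. -/
lemma exists_minimal_subobject [F.Additive] (hA : IsHomFiniteWithGenerator A k) (P : A) :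
    ∃ (K : A) (ι : K ⟶ P), Mono ι ∧ Epi (F.map ι) ∧
      ∀ (T : A) (q : K ⟶ T), Simple T → q ≠ 0 → ¬ IsZero (F.obj T) := by
  classical
  obtain ⟨d, hd0, hd⟩ := hA.exists_length
  -- By right exactness, `Epi (F.map ι)` means that `F` kills the quotient. Minimality refers to the
  -- length `d K`: a simple quotient of `K` killed by `F` would allow passing to its kernel.
  have hex : ∃ n, ∃ (K : A) (ι : K ⟶ P), Mono ι ∧ Epi (F.map ι) ∧ d K = n :=
    ⟨_, P, 𝟙 P, inferInstance, inferInstance, rfl⟩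
  obtain ⟨K, ι, hι, hFι, hK⟩ := Nat.find_spec hex
  refine ⟨K, ι, hι, hFι, fun T q hT hq hz => ?_⟩
  have := epi_of_nonzero_to_simple hq
  have h1 : d K = d (kernel q) + d T := hd _ (shortExact_kernel q)
  have h2 : 0 < d T := Nat.pos_of_ne_zero fun h => not_isZero_of_simple hT (hd0 _ h)
  have hs := (shortExact_kernel q).map_of_exact F
  have : Epi (F.map (kernel.ι q)) := hs.exact.epi_f (hz.eq_of_tgt _ _)
  refine Nat.find_min hex (m := d (kernel q)) (by omega)
    ⟨kernel q, kernel.ι q ≫ ι, mono_comp _ _, ?_, rfl⟩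
  rw [F.map_comp]
  exact epi_comp _ _

/-- For the minimal `K`, `F K ≅ F P` has a simple top. If the kernel of `K ⟶ L` mapped nontrivially
to another simple quotient `T`, its image under `F` would map nontrivially to a simple quotient of
`F T`, hence would be all of `F K`; then `F L = 0`, contrary to minimality. -/
lemma exists_subobject_hasSimpleTop [F.Additive] [Linear k B] (hA : IsHomFiniteWithGenerator A k)
    (hB : IsHomFiniteWithGenerator B k) (P : A) {S : B} (hP : HasSimpleTop (F.obj P) S) :
    ∃ (K L : A) (ι : K ⟶ P), Mono ι ∧ IsZero (F.obj (cokernel ι)) ∧ HasSimpleTop K L ∧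
      ¬ IsZero (F.obj L) := by
  obtain ⟨K, ι, hι, hFι, hK⟩ := exists_minimal_subobject F hA P
  have : IsIso (F.map ι) := isIso_of_mono_of_epi _
  have hFK : HasSimpleTop (F.obj K) S := hP.of_iso (asIso (F.map ι)).symm
  have hK0 : ¬ IsZero K := fun h => hFK.not_isZero (F.map_isZero h)
  obtain ⟨L, p, hL, hp⟩ := hA.exists_simple_quotient hK0
  have hp0 : p ≠ 0 := ne_zero_of_epi_simple hL p
  refine ⟨K, L, ι, hι, (epi_map_iff_isZero F ι).1 hFι,
    hasSimpleTop_of_forall_factor hL p fun T q hT hq => ?_, hK L p hL hp0⟩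
  by_contra hne
  have := epi_of_nonzero_to_simple hne
  have := epi_of_nonzero_to_simple hq
  obtain ⟨U, r, hU, hr⟩ := hB.exists_simple_quotient (hK T q hT hq)
  have hne' : F.map (kernel.ι p) ≫ F.map q ≫ r ≠ 0 := by
    rw [← Category.assoc, ← F.map_comp]
    intro h0
    exact not_isZero_of_simple hU (IsZero.of_epi_eq_zero _ h0)
  have := hFK.epi_of_comp_ne_zero hB (F.map (kernel.ι p)) (F.map q ≫ r) hU hne'
  have hz := (epi_map_iff_isZero F (kernel.ι p)).1 this
  have e : cokernel (kernel.ι p) ≅ L :=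
    (cokernelIsCokernel (kernel.ι p)).coconePointUniqueUpToIso
      (Abelian.epiIsCokernelOfKernel _ (limit.isLimit _))
  exact hK L p hL hp0 (hz.of_iso (F.mapIso e.symm))

end ExactFunctors

/-! ### Adjunctions on abelianizations -/

section FreydAdjunction

variable {V : Type v₁} [Category.{w₁} V] [Preadditive V]
variable {W : Type v₂} [Category.{w₂} W] [Preadditive W]

/-- The adjunction between abelianizations induced by an adjunction of additive functors. -/
def freydAdjunction {F : V ⥤ W} {G : W ⥤ V} [F.Additive] [G.Additive] (adj : F ⊣ G) :
    freydMap F ⊣ freydMap G where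
  unit :=
    { app := fun M => (RightFreyd.quotient V).map ((mapArrowNat adj.unit).app M.as)
      naturality := fun M N f => by
        obtain ⟨f, rfl⟩ := (RightFreyd.quotient V).map_surjective f
        exact congrArg (RightFreyd.quotient V).map ((mapArrowNat adj.unit).naturality f) }
  counit :=
    { app := fun M => (RightFreyd.quotient W).map ((mapArrowNat adj.counit).app M.as)
      naturality := fun M N f => by
        obtain ⟨f, rfl⟩ := (RightFreyd.quotient W).map_surjective f
        exact congrArg (RightFreyd.quotient W).map ((mapArrowNat adj.counit).naturality f) }
  left_triangle_components M := by
    refine Eq.trans (congrArg (RightFreyd.quotient W).map (?_ : F.mapArrow.map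
      ((mapArrowNat adj.unit).app M.as) ≫ (mapArrowNat adj.counit).app (F.mapArrow.obj M.as) =
      𝟙 _)) ((RightFreyd.quotient W).map_id _)
    ext
    · exact adj.left_triangle_components _
    · exact adj.left_triangle_components _
  right_triangle_components M := by
    refine Eq.trans (congrArg (RightFreyd.quotient V).map (?_ :
      (mapArrowNat adj.unit).app (G.mapArrow.obj M.as) ≫ G.mapArrow.map
      ((mapArrowNat adj.counit).app M.as) = 𝟙 _)) ((RightFreyd.quotient V).map_id _)
    ext
    · exact adj.right_triangle_components _
    · exact adj.right_triangle_components _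

/-- An arrow with zero source is a projective object of the abelianization. -/
lemma freyd_iso_of_isZero [HasFiniteBiproducts V] {Z X : V} (a : Z ⟶ X) (hZ : IsZero Z) :
    Nonempty ((RightFreyd.quotient V).obj (Arrow.mk a) ≅ (RightFreyd.functor V).obj X) :=
  ⟨(RightFreyd.quotient V).mapIso (Arrow.isoMk (f := Arrow.mk a)
    (g := (RightFreyd.rightFunctor V).obj X) (hZ.iso (isZero_zero V)) (Iso.refl X)
    (hZ.eq_of_src _ _))⟩

end FreydAdjunction

/-! ### Exactness of the action and indecomposable projectives in a fiat 2-category -/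

section Action

open Bicategory

variable {C : Type u} [Bicategory.{w, v} C]

/-- Composition with adjoint 1-morphisms gives adjoint functors. -/
def postcompAdjunction (i : C) {j l : C} {f : j ⟶ l} {g : l ⟶ j} (adj : Bicategory.Adjunction f g) :
    postcomp i f ⊣ postcomp i g :=
  CategoryTheory.Adjunction.mkOfHomEquiv
    { homEquiv := fun _ _ => adj.homEquiv₂
      homEquiv_naturality_left_symm := fun {X' X Y} η θ => by
        have h : ∀ θ : X ⟶ Y ≫ g, (η ≫ θ) ▷ f ≫ (α_ Y g f).hom ≫ Y ◁ adj.counit ≫ (ρ_ Y).hom =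
            η ▷ f ≫ θ ▷ f ≫ (α_ Y g f).hom ≫ Y ◁ adj.counit ≫ (ρ_ Y).hom := by simp
        exact h θ
      homEquiv_naturality_right := fun {X Y Y'} η θ => by
        have h : ∀ η : X ≫ f ⟶ Y,
            (ρ_ X).inv ≫ X ◁ adj.unit ≫ (α_ X f g).inv ≫ (η ≫ θ) ▷ g =
              ((ρ_ X).inv ≫ X ◁ adj.unit ≫ (α_ X f g).inv ≫ η ▷ g) ≫ θ ▷ g := by simp
        exact h η }

variable [AdditiveTwoCategory C]

lemma actMap_add_app {i j l : C} {f g : j ⟶ l} (η θ : f ⟶ g) (M : PBar i j) :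
    (actMap (η + θ)).app M = (actMap η).app M + (actMap θ).app M := by
  refine congrArg (RightFreyd.quotient _).map
    (?_ : _ = (mapArrowNat ((postcomposing _ _ _).map η)).app M.as +
      (mapArrowNat ((postcomposing _ _ _).map θ)).app M.as)
  ext
  · exact AdditiveTwoCategory.whiskerLeft_add _ _ _
  · exact AdditiveTwoCategory.whiskerLeft_add _ _ _

/-- Composition with `f` turns the chosen zero source into some zero object, not the chosen one, so
this is only an isomorphism. -/
lemma act_obj_PObj_iso {i j l : C} (f : j ⟶ l) (X : i ⟶ j) :
    Nonempty ((act f).obj (PObj X) ≅ PObj (X ≫ f)) :=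
  freyd_iso_of_isZero _ ((postcomp i f).map_isZero (isZero_zero _))

lemma act_obj_PObj_id_iso {i j : C} (f : i ⟶ j) :
    Nonempty ((act f).obj (PObj (𝟙 i)) ≅ PObj f) :=
  ⟨(act_obj_PObj_iso f (𝟙 i)).some ≪≫ (RightFreyd.functor _).mapIso (λ_ f)⟩

variable {k : Type t} [Field k] [LinearTwoCategory k C]

/-- The dual `f*` is right adjoint to `f`; the same statement for `f*`, with `f** ≅ f`, makes it
left adjoint too. Exactness of the action comes from here. -/
lemma IsFiat.exists_biadjoint (hC : IsFiat k C) {j l : C} (f : j ⟶ l) :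
    ∃ g : l ⟶ j, ∀ i : C,
      Nonempty (act (i := i) f ⊣ act g) ∧ Nonempty (act (i := i) g ⊣ act f) := by
  obtain ⟨σ, hσ⟩ := hC.exists_involution
  refine ⟨σ.star.obj (op f), fun i => ⟨?_, ?_⟩⟩
  · exact ⟨freydAdjunction (postcompAdjunction i (hσ f).some)⟩
  · exact ⟨freydAdjunction ((postcompAdjunction i (hσ _).some).ofNatIsoRight
      ((postcomposing i j l).mapIso (σ.starStar f)))⟩

lemma IsFiat.preservesFiniteLimits (hC : IsFiat k C) {i j l : C} (f : j ⟶ l) :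
    PreservesFiniteLimits (act (i := i) f) := by
  obtain ⟨g, hg⟩ := hC.exists_biadjoint f
  have := (hg i).2.some.rightAdjoint_preservesLimits
  infer_instance

lemma IsFiat.preservesFiniteColimits (hC : IsFiat k C) {i j l : C} (f : j ⟶ l) :
    PreservesFiniteColimits (act (i := i) f) := by
  obtain ⟨g, hg⟩ := hC.exists_biadjoint f
  have := (hg i).1.some.leftAdjoint_preservesColimits
  infer_instance

lemma IsFiat.isFiniteSum_indecomposable (hC : IsFiat k C) {i j : C} (f : i ⟶ j) :
    IsFiniteSum (fun g : i ⟶ j => Indecomposable g) f :=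
  CellRep.isFiniteSum_indecomposable k hC.finite_hom f

lemma IsFiat.exists_generator (hC : IsFiat k C) (i j : C) :
    ∃ G : i ⟶ j, ∀ f : i ⟶ j, FactorsThrough (fun g => g = G) f := by
  obtain ⟨n, e, he⟩ := hC.finite_indecomposables i j
  refine ⟨⨁ e, fun f => ?_⟩
  obtain ⟨m, Y, a, b, hY, -, hab⟩ := (hC.isFiniteSum_indecomposable f).exists_retracts
  exact FactorsThrough.of_representatives he ⟨m, Y, a, b, hY, hab⟩

lemma IsFiat.isFreydAbelian (hC : IsFiat k C) (i j : C) : IsFreydAbelian (i ⟶ j) := by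
  obtain ⟨G, hG⟩ := hC.exists_generator i j
  exact CellRep.isFreydAbelian k hC.finite_hom G hG

lemma IsFiat.finite_hom_PBar (hC : IsFiat k C) {i j : C} (M N : PBar i j) :
    Module.Finite k (M ⟶ N) :=
  freyd_finite_hom k hC.finite_hom M N

lemma PBar.exists_epi {i j : C} (M : PBar i j) : ∃ (f : i ⟶ j) (p : PObj f ⟶ M), Epi p :=
  ⟨_, freydCover M.as, inferInstanceAs (Epi (freydCover M.as))⟩

/-- Every object is covered by some `P_f`, and the identity of `f` factors through copies of `G`; so
an object receiving no nonzero map from `P_G` is zero. -/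
lemma IsFiat.isHomFiniteWithGenerator (hC : IsFiat k C) (i j : C) [IsFreydAbelian (i ⟶ j)] :
    IsHomFiniteWithGenerator (PBar i j) k := by
  refine ⟨hC.finite_hom_PBar, ?_⟩
  obtain ⟨G, hG⟩ := hC.exists_generator i j
  refine ⟨PObj G, freyd_projective G, fun M hM => ?_⟩
  by_contra! hcon
  obtain ⟨f, p, hp⟩ := PBar.exists_epi M
  obtain ⟨n, Y, a, b, hY, hab⟩ := (hG f).map (RightFreyd.functor (i ⟶ j)) (Iso.refl (PObj f))
    (Q' := fun M => M = PObj G) (fun Y hY => by rw [hY]; rfl)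
  obtain rfl : Y = fun _ => PObj G := funext hY
  refine hM (IsZero.of_epi_eq_zero p ?_)
  rw [← Category.id_comp p, ← hab, sum_comp]
  exact Finset.sum_eq_zero fun s _ => by rw [Category.assoc, hcon (b s ≫ p), comp_zero]

lemma IsFiat.exists_hasSimpleTop (hC : IsFiat k C) {i j : C} {f : i ⟶ j} (hf : Indecomposable f) :
    ∃ S, HasSimpleTop (PObj f) S := by
  have := hC.isFreydAbelian i j
  have := hC.idempotentComplete i j
  have : Projective (PObj f) := freyd_projective f
  refine (hC.isHomFiniteWithGenerator i j).exists_hasSimpleTop (fun h => hf.1 ?_) fun a => ?_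
  · rw [IsZero.iff_id_eq_zero] at h ⊢
    apply (RightFreyd.functor (i ⟶ j)).map_injective
    rw [CategoryTheory.Functor.map_id, Functor.map_zero]
    exact h
  · obtain ⟨a, rfl⟩ := (RightFreyd.functor (i ⟶ j)).map_surjective a
    rcases isIso_or_isIso_one_sub k hC.finite_hom hf a with h | h
    · exact Or.inl (inferInstanceAs (IsIso ((RightFreyd.functor (i ⟶ j)).map a)))
    · right
      have h2 := (inferInstance : IsIso ((RightFreyd.functor (i ⟶ j)).map (𝟙 f - a)))
      rwa [Functor.map_sub, CategoryTheory.Functor.map_id] at h2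

/-- The epimorphism splits by projectivity, and the splitting descends to 1-morphisms because `f ↦
P_f` is fully faithful. -/
lemma exists_retract_of_epi {i j : C} {d x : i ⟶ j} (π : PObj x ⟶ PObj d) [Epi π] :
    ∃ (s : d ⟶ x) (r : x ⟶ d), s ≫ r = 𝟙 d := by
  have : Projective (PObj d) := freyd_projective d
  let σ : PObj d ⟶ PObj x := Projective.factorThru (𝟙 (PObj d)) π
  have hσ : σ ≫ π = 𝟙 _ := Projective.factorThru_comp _ _
  obtain ⟨r, hr⟩ := (RightFreyd.functor (i ⟶ j)).map_surjective π
  obtain ⟨s, hs⟩ := (RightFreyd.functor (i ⟶ j)).map_surjective σ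
  refine ⟨s, r, (RightFreyd.functor (i ⟶ j)).map_injective ?_⟩
  rw [Functor.map_comp, hr, hs, CategoryTheory.Functor.map_id]
  exact hσ

/-- An indecomposable summand is detected by a nonzero morphism to a simple object. -/
lemma IsFiat.exists_retract_of_hom_ne_zero (hC : IsFiat k C) {i j : C} {d x : i ⟶ j} {S : PBar i j}
    (hd : HasSimpleTop (PObj d) S) (q : PObj x ⟶ S) (hq : q ≠ 0) :
    ∃ (s : d ⟶ x) (r : x ⟶ d), s ≫ r = 𝟙 d := by
  have := hC.isFreydAbelian i j
  have hS : Simple S := hd.1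
  have := epi_of_nonzero_to_simple hq
  have : Projective (PObj x) := freyd_projective x
  obtain ⟨p, hp, -⟩ := hd.2
  let r : PObj x ⟶ PObj d := Projective.factorThru q p
  have hr : r ≫ p = q := Projective.factorThru_comp q p
  have := hd.epi_of_comp_ne_zero (hC.isHomFiniteWithGenerator i j) r p hS (by rwa [hr])
  exact exists_retract_of_epi r

/-- Retracts between indecomposable 1-morphisms are isomorphisms. -/
lemma IsFiat.iso_of_retract (hC : IsFiat k C) {i j : C} {d x : i ⟶ j} (hd : Indecomposable d)
    (hx : Indecomposable x) (s : d ⟶ x) (r : x ⟶ d) (h : s ≫ r = 𝟙 d) : Nonempty (d ≅ x) := by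
  have := hC.idempotentComplete i j
  have hrs : (r ≫ s) ≫ (r ≫ s) = r ≫ s := by rw [Category.assoc, reassoc_of% h]
  rcases isIso_or_isIso_one_sub k hC.finite_hom hx (r ≫ s) with hi | hi
  · have : r ≫ s = 𝟙 x := by rwa [← cancel_epi (r ≫ s), Category.comp_id]
    exact ⟨⟨s, r, h, this⟩⟩
  · exfalso
    apply hd.1
    rw [IsZero.iff_id_eq_zero]
    have h0 : r ≫ s = 0 := by
      rw [← cancel_epi (𝟙 x - r ≫ s), comp_zero, sub_comp, hrs]
      simp
    calc 𝟙 d = (s ≫ r) ≫ (s ≫ r) := by rw [h, Category.id_comp]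
      _ = s ≫ (r ≫ s) ≫ r := by simp only [Category.assoc]
      _ = 0 := by rw [h0, zero_comp, comp_zero]

variable [Bicategory.Strict C]

/-- The action of 1-morphisms on a fixed object `M`, as a functor of the 1-morphism. -/
@[simps]
def actAt {i j l : C} (M : PBar i j) : (j ⟶ l) ⥤ PBar i l where
  obj f := (act f).obj M
  map η := (actMap η).app M
  map_id f := congrArg (fun z => z.toNatTrans.app M) ((principalCore i).map₂_id f)
  map_comp η θ := congrArg (fun z => z.toNatTrans.app M) ((principalCore i).map₂_comp η θ)

instance {i j l : C} (M : PBar i j) : (actAt (l := l) M).Additive where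
  map_add := actMap_add_app _ _ M

lemma act_obj_comp_iso {i j l m : C} (f : j ⟶ l) (g : l ⟶ m) (M : PBar i j) :
    Nonempty ((act (f ≫ g)).obj M ≅ (act g).obj ((act f).obj M)) :=
  ⟨(eqToIso (act_comp f g)).app M⟩

end Action

/-- In a hom-finite category, epimorphic endomorphisms are invertible. -/
lemma isIso_of_epi_endomorphism {V : Type v₁} [Category.{w₁} V] [Preadditive V] (k : Type t)
    [Field k] [Linear k V] (hfin : ∀ X Y : V, Module.Finite k (X ⟶ Y)) {X : V} (f : X ⟶ X) [Epi f] :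
    IsIso f := by
  have := hfin
  have hinj : Function.Injective (Linear.leftComp k X f) := fun x y h => (cancel_epi f).1 h
  obtain ⟨g, hg⟩ := LinearMap.surjective_of_injective hinj (𝟙 X)
  have hg : f ≫ g = 𝟙 X := hg
  refine ⟨g, hg, ?_⟩
  rw [← cancel_epi f, reassoc_of% hg, Category.comp_id]

/-! ### The right preorder and convexity of right cells -/

section RightOrder

open Bicategory

variable {C : Type u} [Bicategory.{w, v} C] [AdditiveTwoCategory C]
variable {k : Type t} [Field k] [LinearTwoCategory k C]

lemma IsFiat.leR_of_retract (hC : IsFiat k C) {i j l : C} {f : i ⟶ j} {g : i ⟶ l} {h : j ⟶ l}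
    (s : g ⟶ f ≫ h) (r : f ≫ h ⟶ g) (hsr : s ≫ r = 𝟙 g) : LeR f g :=
  have := hC.idempotentComplete i l
  ⟨h, isSummand_of_retract s r hsr⟩

lemma LeR.exists_retract {i j l : C} {f : i ⟶ j} {g : i ⟶ l} (h : LeR f g) :
    ∃ (x : j ⟶ l) (s : g ⟶ f ≫ x) (r : f ≫ x ⟶ g), s ≫ r = 𝟙 g := by
  obtain ⟨x, hx⟩ := h
  obtain ⟨s, r, hsr⟩ := hx.exists_retract
  exact ⟨x, s, r, hsr⟩

lemma IsFiat.leR_trans (hC : IsFiat k C) {i j l m : C} {f : i ⟶ j} {g : i ⟶ l} {h : i ⟶ m}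
    (hfg : LeR f g) (hgh : LeR g h) : LeR f h := by
  obtain ⟨x, s, r, hsr⟩ := hfg.exists_retract
  obtain ⟨y, s', r', hsr'⟩ := hgh.exists_retract
  refine hC.leR_of_retract (h := x ≫ y) (s' ≫ s ▷ y ≫ (α_ f x y).hom)
    ((α_ f x y).inv ≫ r ▷ y ≫ r') ?_
  simp only [Category.assoc, Iso.hom_inv_id_assoc]
  rw [← comp_whiskerRight_assoc, hsr, id_whiskerRight, Category.id_comp, hsr']

lemma IsFiat.leR_of_retract_right (hC : IsFiat k C) {i j l : C} {f : i ⟶ j} {g g' : i ⟶ l}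
    (h : LeR f g) (s : g' ⟶ g) (r : g ⟶ g') (hsr : s ≫ r = 𝟙 g') : LeR f g' := by
  obtain ⟨x, s', r', hsr'⟩ := h.exists_retract
  exact hC.leR_of_retract (s ≫ s') (r' ≫ r) (by simp [reassoc_of% hsr', hsr])

lemma IsFiat.leR_comp (hC : IsFiat k C) {i j l : C} (f : i ⟶ j) (h : j ⟶ l) : LeR f (f ≫ h) :=
  hC.leR_of_retract (𝟙 _) (𝟙 _) (Category.comp_id _)

lemma IsFiat.leR_refl (hC : IsFiat k C) {i j : C} (f : i ⟶ j) : LeR f f :=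
  hC.leR_of_retract (ρ_ f).inv (ρ_ f).hom (by simp)

variable {i : C} {R : ∀ j : C, ObjectProperty (i ⟶ j)}

lemma IsRightCell.exists_mem (hR : IsRightCell R) (hC : IsFiat k C) :
    ∃ (l : C) (f : i ⟶ l), R l f := by
  obtain ⟨l, f, hf, h⟩ := hR
  exact ⟨l, f, (h l f).2 ⟨hf, hC.leR_refl f, hC.leR_refl f⟩⟩

lemma IsRightCell.indecomposable (hR : IsRightCell R) {j : C} {f : i ⟶ j} (hf : R j f) :
    Indecomposable f := by
  obtain ⟨l, f₀, -, h⟩ := hR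
  exact ((h j f).1 hf).1

lemma IsRightCell.leR (hR : IsRightCell R) (hC : IsFiat k C) {j l : C} {f : i ⟶ j} {g : i ⟶ l}
    (hf : R j f) (hg : R l g) : LeR f g := by
  obtain ⟨l, f₀, -, h⟩ := hR
  exact hC.leR_trans ((h _ _).1 hf).2.2 ((h _ _).1 hg).2.1

lemma IsRightCell.mem (hR : IsRightCell R) (hC : IsFiat k C) {j l m : C} {f : i ⟶ j} {g : i ⟶ l}
    {x : i ⟶ m} (hf : R j f) (hg : R l g) (hx : Indecomposable x) (h₁ : LeR f x) (h₂ : LeR x g) :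
    R m x := by
  obtain ⟨l, f₀, -, h⟩ := hR
  exact (h _ _).2 ⟨hx, hC.leR_trans ((h _ _).1 hf).2.1 h₁, hC.leR_trans h₂ ((h _ _).1 hg).2.2⟩

end RightOrder

/-! ### The simple object L and its images under the cell -/

section Duflo

open Bicategory

variable {C : Type u} [Bicategory.{w, v} C] [AdditiveTwoCategory C] [Bicategory.Strict C]
variable {k : Type t} [Field k] [LinearTwoCategory k C]

lemma isZero_act_of_retract {i j l : C} {x y : j ⟶ l} (s : x ⟶ y) (r : y ⟶ x) (hsr : s ≫ r = 𝟙 x)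
    {M : PBar i j} (h : IsZero ((act y).obj M)) : IsZero ((act x).obj M) := by
  have h1 : (actAt M).map s ≫ (actAt M).map r = 𝟙 ((actAt M).obj x) := by
    rw [← Functor.map_comp, hsr, CategoryTheory.Functor.map_id]
  rw [IsZero.iff_id_eq_zero]
  refine h1.symm.trans ?_
  rw [show (actAt M).map s = 0 from h.eq_of_tgt _ _, zero_comp]
  rfl

/-- Annihilation passes upwards in the right preorder, so all elements of a right cell annihilate
the same objects. -/
lemma LeR.isZero_act {i j l : C} {f : i ⟶ j} {x : i ⟶ l} (h : LeR f x) {M : PBar i i}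
    (hM : IsZero ((act f).obj M)) : IsZero ((act x).obj M) := by
  obtain ⟨y, s, r, hsr⟩ := h.exists_retract
  exact isZero_act_of_retract s r hsr
    (((act y).map_isZero hM).of_iso (act_obj_comp_iso f y M).some)

variable {i : C} {R : ∀ j : C, ObjectProperty (i ⟶ j)}

theorem IsFiat.exists_isDuflo (hC : IsFiat k C) (hR : IsRightCell R) :
    ∃ (K : PBar i i) (ι : K ⟶ PObj (𝟙 i)) (d : i ⟶ i) (L : PBar i i), IsDuflo R ι d L := by
  have := hC.isFreydAbelian i
  obtain ⟨l, f, hf⟩ := hR.exists_mem hC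
  have := fun {l : C} (f : i ⟶ l) => hC.preservesFiniteLimits (i := i) f
  have := fun {l : C} (f : i ⟶ l) => hC.preservesFiniteColimits (i := i) f
  obtain ⟨S, hS⟩ := hC.exists_hasSimpleTop (hR.indecomposable hf)
  -- Applicable because `f` sends `P_𝟙` to `P_f`, which has a simple top.
  obtain ⟨K, L, ι, hι, hK, hL, hfL⟩ := exists_subobject_hasSimpleTop (act f)
    (hC.isHomFiniteWithGenerator i i) (hC.isHomFiniteWithGenerator i l) (PObj (𝟙 i))
    (hS.of_iso (act_obj_PObj_id_iso f).some.symm)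
  -- To find `g` with `L = L_g`: cover `L` by some `P_x` and pick an indecomposable summand of `x`
  -- on which the cover is nonzero.
  obtain ⟨x, p, hp⟩ := PBar.exists_epi L
  obtain ⟨n, Y, a, b, hY, hab⟩ : FactorsThrough (fun M => ∃ y, Indecomposable y ∧ M = PObj y)
      (PObj x) := by
    obtain ⟨n, Y, a, b, hY, -, hab⟩ := (hC.isFiniteSum_indecomposable x).exists_retracts
    exact FactorsThrough.map (RightFreyd.functor (i ⟶ i)) (Q := fun y => Indecomposable y)
      ⟨n, Y, a, b, hY, hab⟩ (Iso.refl _) (fun y hy => ⟨y, hy, rfl⟩)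
  obtain ⟨s, hs⟩ : ∃ s, b s ≫ p ≠ 0 := by
    by_contra! hcon
    refine ne_zero_of_epi_simple hL.1 p ?_
    rw [← Category.id_comp p, ← hab, sum_comp]
    exact Finset.sum_eq_zero fun s _ => by rw [Category.assoc, hcon s, comp_zero]
  obtain ⟨y, hy, hYy⟩ := hY s
  obtain ⟨q, hq⟩ : ∃ q : PObj y ⟶ L, q ≠ 0 := hYy ▸ ⟨b s ≫ p, hs⟩
  obtain ⟨S', hS'⟩ := hC.exists_hasSimpleTop hy
  refine ⟨K, ι, y, L, hι, fun S hS ⟨N, m, e, hm, he⟩ j g hg => ?_, hy,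
    hS'.of_ne_zero q hL.1 hq, hL, fun j g hg hz => hfL ((hR.leR hC hg hf).isZero_act hz)⟩
  have hN : IsZero ((act g).obj N) :=
    IsZero.of_mono ((act g).map m) ((hR.leR hC hf hg).isZero_act hK)
  exact IsZero.of_epi ((act g).map e) hN

lemma cellObjects_iff (L : PBar i i) {j : C} {M : PBar i j} :
    cellObjects R L j M ↔ ∃ g, R j g ∧ (act g).obj L = M := by
  refine (ObjectProperty.ofObj_iff _ _).trans
    ⟨fun ⟨g, h⟩ => ⟨g.1, g.2, h⟩, fun ⟨g, hg, h⟩ => ⟨⟨g, hg⟩, h⟩⟩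

lemma cellObjects_act (L : PBar i i) {j : C} {g : i ⟶ j} (hg : R j g) :
    cellObjects R L j ((act g).obj L) :=
  (cellObjects_iff L).2 ⟨g, hg, rfl⟩

lemma IsFiat.epi_act_map (hC : IsFiat k C) {j l : C} (x : j ⟶ l) {M N : PBar i j} (p : M ⟶ N)
    [Epi p] : Epi ((act x).map p) := by
  have := hC.preservesFiniteColimits (i := i) x
  infer_instance

namespace IsDuflo

variable {K : PBar i i} {ι : K ⟶ PObj (𝟙 i)} {d : i ⟶ i} {L : PBar i i}

/-- By dévissage `f` kills `P_𝟙 / K`, hence so does `x`; exactness identifies `x K` with `x P_𝟙 ≅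
P_x`. -/
lemma act_obj_iso (hD : IsDuflo R ι d L) (hC : IsFiat k C) {j l : C} {f : i ⟶ j} {x : i ⟶ l}
    (hf : R j f) (hx : LeR f x) : Nonempty ((act x).obj K ≅ PObj x) := by
  have := hC.isFreydAbelian i
  have := fun {l : C} (f : i ⟶ l) => hC.preservesFiniteLimits (i := i) f
  have := fun {l : C} (f : i ⟶ l) => hC.preservesFiniteColimits (i := i) f
  have := hD.mono
  have h0 : IsZero ((act f).obj (cokernel ι)) :=
    isZero_map_of_forall_subquotient (act f) (hC.isHomFiniteWithGenerator i i) _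
      fun S hS hsub => hD.annihilates S hS hsub f hf
  have : Epi ((act x).map ι) := (epi_map_iff_isZero (act x) ι).2 (hx.isZero_act h0)
  have : IsIso ((act x).map ι) := isIso_of_mono_of_epi _
  exact ⟨asIso ((act x).map ι) ≪≫ (act_obj_PObj_id_iso x).some⟩

lemma exists_epi_PObj (hD : IsDuflo R ι d L) (hC : IsFiat k C) :
    ∃ π : PObj d ⟶ K, Epi π := by
  have := hC.isFreydAbelian i
  have : Projective (PObj d) := freyd_projective d
  obtain ⟨p, hp, -⟩ := hD.simpleTop_K.2
  obtain ⟨q, hq, -⟩ := hD.simpleTop_P.2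
  have h : Projective.factorThru q p ≫ p = q := Projective.factorThru_comp q p
  exact ⟨Projective.factorThru q p, hD.simpleTop_K.epi_of_comp_ne_zero
    (hC.isHomFiniteWithGenerator i i) _ p hD.simpleTop_K.1
    (by rw [h]; exact ne_zero_of_epi_simple hD.simpleTop_K.1 q)⟩

/-- Applying `f` to `P_d ↠ K` gives an epimorphism from `P_{f ∘ d}` onto `f K ≅ P_f`, which splits.
-/
lemma leR_of_mem (hD : IsDuflo R ι d L) (hC : IsFiat k C) {j : C} {f : i ⟶ j} (hf : R j f) :
    LeR d f := by
  obtain ⟨π, hπ⟩ := hD.exists_epi_PObj hC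
  have := hC.epi_act_map f π
  let π' : PObj (d ≫ f) ⟶ PObj f := (act_obj_PObj_iso f d).some.inv ≫ (act f).map π ≫
    (hD.act_obj_iso hC hf (hC.leR_refl f)).some.hom
  have : Epi π' := epi_comp _ _
  obtain ⟨s, r, hsr⟩ := exists_retract_of_epi π'
  exact hC.leR_of_retract s r hsr

/-- The epimorphism `P_x ≅ x K ⟶ x L` is nonzero. Its transpose under adjunction is a nonzero map
from `P_{y ∘ x}` to `L = L_d`, so `d` is a retract of `y ∘ x`. -/
lemma leR_of_not_isZero (hD : IsDuflo R ι d L) (hC : IsFiat k C) {j l : C} {f : i ⟶ j} {x : i ⟶ l}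
    (hf : R j f) (hx : LeR f x) (hxL : ¬ IsZero ((act x).obj L)) : LeR x d := by
  obtain ⟨p, hp, -⟩ := hD.simpleTop_K.2
  have := hC.epi_act_map x p
  obtain ⟨y, hy⟩ := hC.exists_biadjoint x
  let adj := (hy i).2.some
  let q : PObj x ⟶ (act x).obj L := (hD.act_obj_iso hC hf hx).some.inv ≫ (act x).map p
  have : Epi q := epi_comp _ _
  have hq : q ≠ 0 := fun h => hxL (IsZero.of_epi_eq_zero q h)
  let q' : (act y).obj (PObj x) ⟶ L := (adj.homEquiv _ _).symm q
  have hq' : q' ≠ 0 := fun h => hq (by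
    have h2 : q = adj.homEquiv _ _ q' := ((adj.homEquiv _ _).apply_symm_apply q).symm
    rw [h2, h, adj.homEquiv_unit, Functor.map_zero, comp_zero])
  obtain ⟨s, r, hsr⟩ := hC.exists_retract_of_hom_ne_zero hD.simpleTop_P
    ((act_obj_PObj_iso y x).some.inv ≫ q') (fun h => hq' (by
      rw [← cancel_epi (act_obj_PObj_iso y x).some.inv, h, comp_zero]))
  exact hC.leR_of_retract s r hsr

lemma mem_of_not_isZero (hD : IsDuflo R ι d L) (hC : IsFiat k C) (hR : IsRightCell R) {j l : C}
    {f : i ⟶ j} {x : i ⟶ l} (hf : R j f) (hx : LeR f x) (hi : Indecomposable x)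
    (hxL : ¬ IsZero ((act x).obj L)) : R l x :=
  hR.mem hC hf hf hi hx
    (hC.leR_trans (hD.leR_of_not_isZero hC hf hx hxL) (hD.leR_of_mem hC hf))

lemma mem (hD : IsDuflo R ι d L) (hC : IsFiat k C) (hR : IsRightCell R) : R i d := by
  obtain ⟨j, f, hf⟩ := hR.exists_mem hC
  exact hR.mem hC hf hf hD.indecomposable
    (hD.leR_of_not_isZero hC hf (hC.leR_refl f) (hD.not_isZero f hf)) (hD.leR_of_mem hC hf)

/-- The objects `x L`, with `x` above the cell, are direct sums of objects `h L`, with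
`h` in the cell. -/
lemma isFiniteSum_act (hD : IsDuflo R ι d L) (hC : IsFiat k C) (hR : IsRightCell R) {j l : C}
    {f : i ⟶ j} {x : i ⟶ l} (hf : R j f) (hx : LeR f x) :
    IsFiniteSum (cellObjects R L l) ((act x).obj L) := by
  have hsum : IsFiniteSum (fun y : i ⟶ l => Indecomposable y ∧ LeR f y) x := by
    obtain ⟨n, Y, hY, ⟨e⟩⟩ := hC.isFiniteSum_indecomposable x
    exact ⟨n, Y, fun s => ⟨hY s, hC.leR_of_retract_right hx (biproduct.ι Y s ≫ e.inv)
      (e.hom ≫ biproduct.π Y s) (by simp)⟩, ⟨e⟩⟩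
  refine hsum.map (actAt L) fun y hy => ?_
  by_cases hz : IsZero ((act y).obj L)
  · exact .of_isZero hz
  · exact .of_prop (cellObjects_act L (hD.mem_of_not_isZero hC hR hf hy.2 hy.1 hz))

/-- A nonzero map `x K ≅ P_x ⟶ L` forces `x ≅ d`, so `x L ≠ 0`. Then `u` and the composite of `x K ⟶
x L` with a simple quotient are two nonzero maps from `P_x` to simples, which differ by an
isomorphism because the top is simple. -/
lemma exists_factor_indecomposable (hD : IsDuflo R ι d L) (hC : IsFiat k C) (hR : IsRightCell R)
    {j : C} {f : i ⟶ j} {x : i ⟶ i} (hf : R j f) (hx : LeR f x) (hi : Indecomposable x)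
    (p : K ⟶ L) [Epi p] (u : (act x).obj K ⟶ L) : ∃ v, (act x).map p ≫ v = u := by
  have := hC.isFreydAbelian i
  by_cases hu : u = 0
  · exact ⟨0, by rw [hu, comp_zero]⟩
  obtain ⟨e⟩ := hD.act_obj_iso hC hf hx
  obtain ⟨s, r, hsr⟩ := hC.exists_retract_of_hom_ne_zero hD.simpleTop_P (e.inv ≫ u) (fun h => hu (by
    rw [← cancel_epi e.inv, h, comp_zero]))
  obtain ⟨φ⟩ := hC.iso_of_retract hD.indecomposable hi s r hsr
  have hxL : ¬ IsZero ((act x).obj L) := fun h =>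
    hD.not_isZero d (hD.mem hC hR) (h.of_iso ((actAt L).mapIso φ))
  obtain ⟨S, hS⟩ := hC.exists_hasSimpleTop hi
  obtain ⟨T, q, hT, hq⟩ := (hC.isHomFiniteWithGenerator i i).exists_simple_quotient hxL
  have := hC.epi_act_map x p
  obtain ⟨ψ, hψ⟩ := (hS.of_iso e.symm).factor ((act x).map p ≫ q) hT
    (ne_zero_of_epi_simple hT _) u hD.simpleTop_K.1 hu
  exact ⟨q ≫ ψ.hom, by rw [hψ, Category.assoc]⟩

lemma exists_factor_to_simple (hD : IsDuflo R ι d L) (hC : IsFiat k C) (hR : IsRightCell R)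
    {j : C} {f : i ⟶ j} {x : i ⟶ i} (hf : R j f) (hx : LeR f x)
    (p : K ⟶ L) [Epi p] (u : (act x).obj K ⟶ L) : ∃ v, (act x).map p ≫ v = u := by
  obtain ⟨n, Y, a, b, hY, hba, hab⟩ := (hC.isFiniteSum_indecomposable x).exists_retracts
  choose v hv using fun s => hD.exists_factor_indecomposable hC hR hf
    (hC.leR_of_retract_right hx (b s) (a s) (hba s)) (hY s) p ((actMap (b s)).app K ≫ u)
  refine ⟨∑ s, (actMap (a s)).app L ≫ v s, ?_⟩
  have h1 : ∀ s, (act x).map p ≫ (actMap (a s)).app L ≫ v s =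
      (actMap (a s)).app K ≫ (actMap (b s)).app K ≫ u := fun s => by
    rw [← hv s, ← Category.assoc, ← Category.assoc, (actMap (a s)).naturality]
  have h2 : ∑ s, (actMap (a s)).app K ≫ (actMap (b s)).app K = 𝟙 ((act x).obj K) := by
    have := congrArg (actAt K).map hab
    rw [Functor.map_sum, CategoryTheory.Functor.map_id] at this
    refine Eq.trans (Finset.sum_congr rfl fun s _ => ?_) this
    exact ((actAt K).map_comp _ _).symm
  calc (act x).map p ≫ ∑ s, (actMap (a s)).app L ≫ v s
      = ∑ s, ((actMap (a s)).app K ≫ (actMap (b s)).app K) ≫ u := by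
        rw [comp_sum]
        exact Finset.sum_congr rfl fun s _ => by rw [h1, Category.assoc]
    _ = u := by rw [← sum_comp, h2, Category.id_comp]

/-- All morphisms from `f K` to `h L` factor through `f L`. -/
lemma exists_factor (hD : IsDuflo R ι d L) (hC : IsFiat k C) (hR : IsRightCell R)
    {j : C} {f h : i ⟶ j} (hf : R j f) (p : K ⟶ L) [Epi p]
    (u : (act f).obj K ⟶ (act h).obj L) : ∃ v, (act f).map p ≫ v = u := by
  obtain ⟨g, hg⟩ := hC.exists_biadjoint h
  let adj := (hg i).2.some
  -- The adjoint `g` of `h` moves the problem to maps `(g ∘ f) K ⟶ L`, and `g ∘ f` is still above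
  -- the cell.
  let e : act (i := i) (f ≫ g) ≅ act f ⋙ act g := eqToIso (act_comp f g)
  obtain ⟨v, hv⟩ := hD.exists_factor_to_simple hC hR hf (hC.leR_comp f g) p
    (e.hom.app K ≫ (adj.homEquiv _ _).symm u)
  refine ⟨adj.homEquiv _ _ (e.inv.app L ≫ v), ?_⟩
  rw [← adj.homEquiv_naturality_left]
  have h1 : (act g).map ((act f).map p) ≫ e.inv.app L = e.inv.app K ≫ (act (f ≫ g)).map p :=
    e.inv.naturality p
  rw [reassoc_of% h1, hv, Iso.inv_hom_id_app_assoc, Equiv.apply_symm_apply]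

lemma exists_epi_factor (hD : IsDuflo R ι d L) (hC : IsFiat k C) (hR : IsRightCell R)
    {j : C} {f : i ⟶ j} (hf : R j f) : ∃ π : PObj f ⟶ (act f).obj L, Epi π ∧
      ∀ (h : i ⟶ j) (u : PObj f ⟶ (act h).obj L), ∃ v, π ≫ v = u := by
  obtain ⟨p, hp, -⟩ := hD.simpleTop_K.2
  have := hC.epi_act_map f p
  obtain ⟨e⟩ := hD.act_obj_iso hC hf (hC.leR_refl f)
  refine ⟨e.inv ≫ (act f).map p, epi_comp _ _, fun h u => ?_⟩
  obtain ⟨v, hv⟩ := hD.exists_factor hC hR hf p (e.hom ≫ u)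
  exact ⟨v, by rw [Category.assoc, hv, e.inv_hom_id_assoc]⟩

/-- All morphisms from `P_f` to `h L` factor through any given epimorphism `P_f ⟶ f L`. -/
lemma exists_factor_of_epi (hD : IsDuflo R ι d L) (hC : IsFiat k C) (hR : IsRightCell R)
    {j : C} {f : i ⟶ j} (hf : R j f) (π : PObj f ⟶ (act f).obj L) [Epi π] (h : i ⟶ j)
    (u : PObj f ⟶ (act h).obj L) : ∃ v, π ≫ v = u := by
  have := hC.isFreydAbelian i
  obtain ⟨π', hπ', H⟩ := hD.exists_epi_factor hC hR hf
  -- The given epimorphism is the canonical one followed by an epimorphic endomorphism of `f L`,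
  -- which is invertible by hom-finiteness.
  obtain ⟨v, hv⟩ := H f π
  obtain ⟨w, hw⟩ := H h u
  have : Epi v := by
    have : Epi (π' ≫ v) := by rwa [hv]
    exact epi_of_epi π' v
  have : IsIso v := isIso_of_epi_endomorphism k hC.finite_hom_PBar v
  exact ⟨inv v ≫ w, by rw [← hv, Category.assoc, IsIso.hom_inv_id_assoc, hw]⟩

end IsDuflo

end Duflo

/-! ### Morphism spaces, kernels and the cell category -/

section CellCategory

open Bicategory

variable {C : Type u} [Bicategory.{w, v} C] [AdditiveTwoCategory C] [Bicategory.Strict C]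
variable {k : Type t} [Field k] [LinearTwoCategory k C]
variable {i : C} {R : ∀ j : C, ObjectProperty (i ⟶ j)}

/-- The objects of a right cell have finitely many isomorphism classes of images of `L`. -/
lemma IsFiat.exists_representatives (hC : IsFiat k C) (hR : IsRightCell R) (L : PBar i i) (j : C) :
    ∃ (n : ℕ) (r : Fin n → PBar i j), (∀ s, cellObjects R L j (r s)) ∧
      ∀ X, cellObjects R L j X → ∃ s, Nonempty (X ≅ r s) := by
  classical
  obtain ⟨n, e, he⟩ := hC.finite_indecomposables i j
  let J := {s : Fin n // ∃ g, R j g ∧ Nonempty (g ≅ e s)}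
  choose g hg using fun s : J => s.2
  refine ⟨Fintype.card J, fun s => (act (g ((Fintype.equivFin J).symm s))).obj L,
    fun s => cellObjects_act L (hg _).1, fun X hX => ?_⟩
  obtain ⟨f, hf, rfl⟩ := (cellObjects_iff L).1 hX
  obtain ⟨s, ⟨φ⟩⟩ := he f (hR.indecomposable hf)
  let s' : J := ⟨s, f, hf, ⟨φ⟩⟩
  refine ⟨Fintype.equivFin J s', ⟨(actAt L).mapIso (φ ≪≫ (hg s').2.some.symm) ≪≫ eqToIso ?_⟩⟩
  simp

namespace IsDuflo

variable {K : PBar i i} {ι : K ⟶ PObj (𝟙 i)} {d : i ⟶ i} {L : PBar i i}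

lemma exists_biproduct_iso (hD : IsDuflo R ι d L) (hC : IsFiat k C) (hR : IsRightCell R)
    {j l : C} (f : j ⟶ l) {g : i ⟶ j} (hg : R j g) :
    ∃ (n : ℕ) (h : Fin n → (i ⟶ l)), (∀ s, R l (h s)) ∧
      Nonempty ((act (g ≫ f)).obj L ≅ ⨁ fun s => (act (h s)).obj L) := by
  obtain ⟨n, Y, hY, e⟩ := hD.isFiniteSum_act hC hR hg (hC.leR_comp g f)
  choose h hh hY using fun s => (cellObjects_iff L).1 (hY s)
  obtain rfl : (fun s => (act (h s)).obj L) = Y := funext hY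
  exact ⟨n, h, hh, e⟩

/-- Restriction along `P_f ↠ f L` is injective, and surjective by the factorization property; so the
dimension is that of `Hom(P_f, h L)`. Over an algebraically closed field Schur's lemma removes the
factor. -/
lemma finrank_hom (hD : IsDuflo R ι d L) (hC : IsFiat k C) (hR : IsRightCell R)
    {j : C} {f : i ⟶ j} (hf : R j f) (h : i ⟶ j) :
    ∃ (S : PBar i j) (m : ℕ), HasSimpleTop (PObj f) S ∧ CompMult S ((act h).obj L) m ∧
      Module.finrank k ((act f).obj L ⟶ (act h).obj L) = m * Module.finrank k (S ⟶ S) ∧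
      (IsAlgClosed k → Module.finrank k ((act f).obj L ⟶ (act h).obj L) = m) := by
  have := hC.isFreydAbelian i
  obtain ⟨S, hS⟩ := hC.exists_hasSimpleTop (hR.indecomposable hf)
  obtain ⟨m, hm⟩ := (hC.isHomFiniteWithGenerator i j).exists_compMult S ((act h).obj L)
  have : Projective (PObj f) := freyd_projective f
  obtain ⟨π, hπ, H⟩ := hD.exists_epi_factor hC hR hf
  have h1 : Module.finrank k ((act f).obj L ⟶ (act h).obj L) =
      Module.finrank k (PObj f ⟶ (act h).obj L) :=
    LinearEquiv.finrank_eq (LinearEquiv.ofBijective (Linear.leftComp k ((act h).obj L) π)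
      ⟨fun x y hxy => (cancel_epi π).1 hxy, H h⟩)
  have h2 := h1.trans (finrank_hom_eq_mul hC.finite_hom_PBar hS hm)
  refine ⟨S, m, hS, hm, h2, fun hk => ?_⟩
  have := hS.1
  have := hC.finite_hom_PBar S S
  rw [h2, finrank_endomorphism_simple_eq_one k S, mul_one]

/-- Each component `P_{f s} ⟶ P_{f t} ⟶ f t L` of `φ` factors through `π s`, hence vanishes on the
kernel of `π s`. -/
lemma kernels_stable (hD : IsDuflo R ι d L) (hC : IsFiat k C) (hR : IsRightCell R)
    {j : C} {n : ℕ} {f : Fin n → (i ⟶ j)} (hf : ∀ s, R j (f s))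
    (π : ∀ s, PObj (f s) ⟶ (act (f s)).obj L) (hπ : ∀ s, Epi (π s))
    (Ker : Fin n → PBar i j) (κ : ∀ s, Ker s ⟶ PObj (f s)) (hκ : ∀ s, κ s ≫ π s = 0)
    (hlim : ∀ s, Nonempty (IsLimit (KernelFork.ofι (κ s) (hκ s))))
    (φ : (⨁ fun s => PObj (f s)) ⟶ (⨁ fun s => PObj (f s))) :
    ∃ ψ : ⨁ Ker ⟶ ⨁ Ker, ψ ≫ biproduct.map κ = biproduct.map κ ≫ φ := by
  have hzero : ∀ t, (biproduct.map κ ≫ φ ≫ biproduct.π _ t) ≫ π t = 0 := fun t => by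
    refine biproduct.hom_ext' _ _ fun s => ?_
    obtain ⟨v, hv⟩ := hD.exists_factor_of_epi hC hR (hf s) (π s) (f t)
      (biproduct.ι (fun s => PObj (f s)) s ≫ φ ≫ biproduct.π _ t ≫ π t)
    simp only [Category.assoc, biproduct.ι_map_assoc, comp_zero]
    rw [← hv, reassoc_of% (hκ s), zero_comp]
  refine ⟨biproduct.lift fun t => (hlim t).some.lift (KernelFork.ofι _ (hzero t)),
    biproduct.hom_ext _ _ fun t => ?_⟩
  rw [Category.assoc, biproduct.map_π, biproduct.lift_π_assoc, Category.assoc]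
  exact (hlim t).some.fac (KernelFork.ofι _ (hzero t)) WalkingParallelPair.zero

/-- The objects `g L` are projective relative to the presentations defining the cell category. -/
lemma exactOn (hD : IsDuflo R ι d L) (hC : IsFiat k C) (hR : IsRightCell R) {j : C}
    (G : PBar i j) (hG : cellObjects R L j G) {X₁ X₀ M : PBar i j} (a : X₁ ⟶ X₀) (p : X₀ ⟶ M)
    (w : a ≫ p = 0) (h₁ : addClosure (cellObjects R L j) X₁)
    (h₀ : addClosure (cellObjects R L j) X₀)
    (hp : Nonempty (IsColimit (CokernelCofork.ofπ p w))) : ExactOn G a p := by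
  have := hC.isFreydAbelian i
  obtain ⟨hp⟩ := hp
  have ep : Epi p := ⟨fun f g h => Cofork.IsColimit.hom_ext hp h⟩
  obtain ⟨g, hg, rfl⟩ := (cellObjects_iff L).1 hG
  obtain ⟨π, hπ, H⟩ := hD.exists_epi_factor hC hR hg
  have : Projective (PObj g) := freyd_projective g
  have H₁ : ∀ {Z : PBar i j}, cellObjects R L j Z → ∀ u : PObj g ⟶ Z, ∃ v, π ≫ v = u := by
    intro Z hZ u
    obtain ⟨h, -, rfl⟩ := (cellObjects_iff L).1 hZ
    exact H h u
  -- Factorization through `π` extends to the additive closure. Below, maps are lifted from `P_g` by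
  -- projectivity and then descend to `g L` by this property.
  have H' : ∀ {X : PBar i j}, addClosure (cellObjects R L j) X → ∀ u : PObj g ⟶ X,
      ∃ v, π ≫ v = u := by
    intro X hX u
    obtain ⟨n, Y, a, b, hY, hab⟩ := factorsThrough_of_addClosure hX
    have : ∀ s, ∃ v, π ≫ v = u ≫ a s := fun s => H₁ (hY s) (u ≫ a s)
    choose v hv using this
    refine ⟨∑ s, v s ≫ b s, ?_⟩
    rw [comp_sum, ← Category.comp_id u, ← hab, comp_sum]
    exact Finset.sum_congr rfl fun s _ => by rw [reassoc_of% (hv s)]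
  constructor
  · intro f
    obtain ⟨v, hv⟩ := H' h₀ (Projective.factorThru (π ≫ f) p)
    refine ⟨v, ?_⟩
    rw [← cancel_epi π, reassoc_of% hv, Projective.factorThru_comp]
  · intro f hf
    have hex : (ShortComplex.mk a p w).Exact := ShortComplex.exact_of_g_is_cokernel _ hp
    have hπf : (π ≫ f) ≫ p = 0 := by rw [Category.assoc, hf, comp_zero]
    obtain ⟨v, hv⟩ := H' h₁ (hex.liftFromProjective (π ≫ f) hπf)
    refine ⟨v, ?_⟩
    rw [← cancel_epi π, reassoc_of% hv]
    exact hex.liftFromProjective_comp _ _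

lemma exists_equivalence_opMod (hD : IsDuflo R ι d L) (hC : IsFiat k C) (hR : IsRightCell R)
    (j : C) : ∃ e : (cellCategory R L j).FullSubcategory ≌
      OpMod k (cellObjects R L j).FullSubcategory, e.functor.Linear k :=
  CellRep.exists_equivalence_opMod _ hC.finite_hom_PBar (hC.exists_representatives hR L j)
    (fun _ => factorsThrough_of_addClosure) (fun _ => addClosure_of_isFiniteSum)
    (fun G hG _ _ _ a p w h₁ h₀ hp => hD.exactOn hC hR G hG a p w h₁ h₀ hp)

/-- The algebra is the opposite endomorphism algebra of the sum of representatives of the finitely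
many `g L`. -/
lemma isModuleCategory (hD : IsDuflo R ι d L) (hC : IsFiat k C) (hR : IsRightCell R) (j : C) :
    IsModuleCategory k (cellCategory R L j).FullSubcategory := by
  obtain ⟨n, r, hr, hrep⟩ := hC.exists_representatives hR L j
  obtain ⟨e, he⟩ := exists_equivalence_fgModuleCat (⨁ r) (addClosure (cellObjects R L j)) k
    hC.finite_hom_PBar
    (fun X hX => (factorsThrough_of_addClosure hX).of_representatives hrep)
    (fun m => addClosure_of_isFiniteSum
      (IsFiniteSum.biproduct fun _ => IsFiniteSum.biproduct fun s => .of_prop (hr s)))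
    (fun X₁ X₀ M a p w h₁ h₀ hp =>
      ExactOn.biproduct fun s => hD.exactOn hC hR (r s) (hr s) a p w h₁ h₀ hp)
  exact ⟨(End (⨁ r))ᵐᵒᵖ, inferInstance, inferInstance, e,
    finite_end_op _ k hC.finite_hom_PBar, he⟩

/-- The action is right exact, so it preserves presentations, and it sends each `g L` to a sum of
objects `h L` with `h` in the cell. -/
lemma cellCategory_act (hD : IsDuflo R ι d L) (hC : IsFiat k C) (hR : IsRightCell R) {j l : C}
    (f : j ⟶ l) {M : PBar i j} (hM : cellCategory R L j M) :
    cellCategory R L l ((act f).obj M) := by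
  have := hC.preservesFiniteColimits (i := i) f
  have hadd : ∀ X, addClosure (cellObjects R L j) X →
      addClosure (cellObjects R L l) ((act f).obj X) := fun X hX => by
    refine addClosure_map (act f) hX fun Y hY => ?_
    obtain ⟨g, hg, rfl⟩ := (cellObjects_iff L).1 hY
    exact (hD.isFiniteSum_act hC hR hg (hC.leR_comp g f)).of_iso
      (act_obj_comp_iso g f L).some.symm
  obtain ⟨X₁, X₀, a, p, w, h₁, h₀, ⟨hp⟩⟩ := hM
  exact ⟨_, _, (act f).map a, (act f).map p, by rw [← Functor.map_comp, w, Functor.map_zero],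
    hadd _ h₁, hadd _ h₀, ⟨CokernelCofork.mapIsColimit _ hp (act f)⟩⟩

end IsDuflo

end CellCategory

end CellRep

end

theorem theorem3 {k : Type t} [Field k] {C : Type u} [Bicategory.{w, v} C]
    [Bicategory.Strict C] [AdditiveTwoCategory C] [LinearTwoCategory k C] (hC : IsFiat k C)
    {i : C} (R : ∀ j : C, ObjectProperty (i ⟶ j)) (hR : IsRightCell R) :
    (∃ (K : PBar i i) (ι : K ⟶ PObj (𝟙 i)) (d : i ⟶ i) (L : PBar i i), IsDuflo R ι d L) ∧
    ∀ (K : PBar i i) (ι : K ⟶ PObj (𝟙 i)) (d : i ⟶ i) (L : PBar i i), IsDuflo R ι d L →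
      (∀ (j l : C) (f : j ⟶ l) (g : i ⟶ j), Indecomposable f → R j g →
        ∃ (n : ℕ) (h : Fin n → (i ⟶ l)), (∀ s, R l (h s)) ∧
          Nonempty ((act (g ≫ f)).obj L ≅ ⨁ fun s => (act (h s)).obj L)) ∧
      (∀ (j : C) (f h : i ⟶ j), R j f → R j h →
        Module.Finite k ((act f).obj L ⟶ (act h).obj L) ∧
        ∃ (S : PBar i j) (m : ℕ), HasSimpleTop (PObj f) S ∧ CompMult S ((act h).obj L) m ∧
          Module.finrank k ((act f).obj L ⟶ (act h).obj L) = m * Module.finrank k (S ⟶ S) ∧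
          (IsAlgClosed k → Module.finrank k ((act f).obj L ⟶ (act h).obj L) = m)) ∧
      (∀ (j : C) (f : i ⟶ j), R j f →
        ∃ π : PObj f ⟶ (act f).obj L, Epi π ∧ HasKernel π) ∧
      (∀ (j : C) (n : ℕ) (f : Fin n → (i ⟶ j)), (∀ s, R j (f s)) →
        ∀ (π : ∀ s, PObj (f s) ⟶ (act (f s)).obj L), (∀ s, Epi (π s)) →
        ∀ (Ker : Fin n → PBar i j) (κ : ∀ s, Ker s ⟶ PObj (f s)) (hκ : ∀ s, κ s ≫ π s = 0),
          (∀ s, Nonempty (IsLimit (KernelFork.ofι (κ s) (hκ s)))) →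
          ∀ φ : (⨁ fun s => PObj (f s)) ⟶ (⨁ fun s => PObj (f s)),
            ∃ ψ : ⨁ Ker ⟶ ⨁ Ker, ψ ≫ biproduct.map κ = biproduct.map κ ≫ φ) ∧
      (∀ j : C, ∃ e : (cellCategory R L j).FullSubcategory ≌
          OpMod k (cellObjects R L j).FullSubcategory, e.functor.Linear k) ∧
      (∃ hst : (principal (k := k) i).IsStable (cellCategory R L),
        ∀ j : C, IsModuleCategory k
          (((principal (k := k) i).restrict (cellCategory R L) hst).toTwoFunctor.obj j)) := by
  refine ⟨hC.exists_isDuflo hR, fun K ι d L hD => ⟨?_, ?_, ?_, ?_, ?_, ?_⟩⟩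
  · exact fun j l f g _ hg => hD.exists_biproduct_iso hC hR f hg
  · exact fun j f h hf _ => ⟨hC.finite_hom_PBar _ _, hD.finrank_hom hC hR hf h⟩
  · intro j f hf
    have := hC.isFreydAbelian i j
    obtain ⟨π, hπ, -⟩ := hD.exists_epi_factor hC hR hf
    exact ⟨π, hπ, inferInstance⟩
  · exact fun j n f hf π hπ Ker κ hκ hlim φ => hD.kernels_stable hC hR hf π hπ Ker κ hκ hlim φ
  · exact hD.exists_equivalence_opMod hC hR
  -- The restricted 2-representation has, by definition, the full subcategory `cellCategory R L j`
  -- as its value at `j`.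
  · exact ⟨fun j l f X hX => hD.cellCategory_act hC hR f hX, fun j => hD.isModuleCategory hC hR j⟩
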